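/- Let $N$ be a positive integer. For $i,j,k\in\{1,\dots,N\}$ write $\circlearrowleft(i\le j\le k)$ if one of the sequences $(i,j,k)$, $(j,k,i)$, $(k,i,j)$ is weakly increasing and, in case $i=k$, moreover $i=j=k$. Define a product on complex $N\times N$ matrices by $$(P\bullet Q)_{ik}=\sum_{j:\ \circlearrowleft(i\le j\le k)}P_{ij}Q_{jk},$$ and let $E$ be the affine scheme over $\mathbb C$ of $N\times N$ matrices $M$ with $M\bullet M=0$ and zero diagonal, i.e. the spectrum of the quotient of $\mathbb C[M_{ij}]$ by the ideal generated by all the $M_{ii}$ and all the entries of $M\bullet M$. A link pattern is an involution $\pi$ of $\{1,\dots,N\}$ with no fixed point if $N$ is even and exactly one fixed point if $N$ is odd. For a link pattern $\pi$ let $$E_\pi:=\overline{\{M\in E:\ \text{for all } i,j,\ (M^2)_{ii}=(M^2)_{jj}\text{ if and only if } j\in\{i,\pi(i)\}\}}\subseteq E,$$ where $M^2$ is the ordinary matrix square and the closure is taken in the Zariski topology. Then $\dim E=\lfloor N^2/2\rfloor$; for each link pattern $\pi$, $E_\pi$ is irreducible; and $\pi\mapsto E_\pi$ is a bijection from the set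 of link patterns of size $N$ onto the set of irreducible components of $E$ of dimension $\dim E$. -/

import Mathlib

namespace BrauerLoop

open AlgebraicGeometry

/-- The triple `(i, j, k)` is cyclically ordered: one of its rotations is weakly increasing, and
all three entries agree if the first and the last do. -/
def CycLE {N : ℕ} (i j k : Fin N) : Prop :=
  ((i ≤ j ∧ j ≤ k) ∨ (j ≤ k ∧ k ≤ i) ∨ (k ≤ i ∧ i ≤ j)) ∧ (i = k → i = j ∧ j = k)

instance {N : ℕ} (i j k : Fin N) : Decidable (CycLE i j k) := by
  unfold CycLE; infer_instance

/-- The degenerate matrix product `(P ∘ Q)_{ik} = ∑_j P_{ij} Q_{jk}`, the sum running over those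
`j` for which `(i, j, k)` is cyclically ordered. -/
def cycMul {N : ℕ} {R : Type*} [CommRing R] (P Q : Matrix (Fin N) (Fin N) R) :
    Matrix (Fin N) (Fin N) R :=
  Matrix.of fun i k => ∑ j : Fin N, if CycLE i j k then P i j * Q j k else 0

/-- The `N × N` matrix of coordinate functions on the affine space of complex `N × N` matrices. -/
noncomputable def coordMatrix (N : ℕ) :
    Matrix (Fin N) (Fin N) (MvPolynomial (Fin N × Fin N) ℂ) :=
  Matrix.of fun i j => MvPolynomial.X (i, j)

/-- The ideal generated by the diagonal entries of `M` and all the entries of `M ∘ M`. -/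
noncomputable def brauerIdeal (N : ℕ) : Ideal (MvPolynomial (Fin N × Fin N) ℂ) :=
  Ideal.span
    ({f | ∃ i : Fin N, f = coordMatrix N i i} ∪
      {f | ∃ i k : Fin N, f = cycMul (coordMatrix N) (coordMatrix N) i k})

/-- The coordinate ring of the Brauer loop scheme. -/
abbrev CoordRing (N : ℕ) : Type :=
  MvPolynomial (Fin N × Fin N) ℂ ⧸ brauerIdeal N

/-- The Brauer loop scheme `E = {M : M ∘ M = 0, diag M = 0}`. -/
noncomputable abbrev brauerLoopScheme (N : ℕ) : Scheme :=
  Spec (CommRingCat.of (CoordRing N))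

/-- The matrix, over the residue field of the point `x` of `E`, which `x` represents. -/
noncomputable def matrixAt {N : ℕ} (x : PrimeSpectrum (CoordRing N)) :
    Matrix (Fin N) (Fin N) x.asIdeal.ResidueField :=
  Matrix.of fun i j =>
    algebraMap (CoordRing N) x.asIdeal.ResidueField
      (Ideal.Quotient.mk (brauerIdeal N) (coordMatrix N i j))

/-- A link pattern of size `N`: an involution of an `N`-element set with no fixed point if `N` is
even and exactly one fixed point if `N` is odd. -/
def LinkPattern (N : ℕ) : Type :=
  {π : Equiv.Perm (Fin N) //
    Function.Involutive π ∧ (Function.fixedPoints π).ncard = N % 2}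

/-- The locus of those `M` in `E` for which `(M²)_{ii} = (M²)_{jj}` (ordinary square) if and only
if `j ∈ {i, π(i)}`. -/
def locus {N : ℕ} (π : LinkPattern N) : Set (brauerLoopScheme N) :=
  {x | ∀ i j : Fin N,
    (matrixAt x * matrixAt x) i i = (matrixAt x * matrixAt x) j j ↔ (j = i ∨ j = π.1 i)}

/-- `E_π`, the Zariski closure of the locus of `π` in `E`. -/
def component {N : ℕ} (π : LinkPattern N) : Set (brauerLoopScheme N) :=
  closure (locus π)

end BrauerLoop

/-! Write M = U + L with U strictly upper and L strictly lower triangular. The equations of E say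
that U² = 0 and that UL + LU is upper triangular (`isPt_iff`). The group B of invertible upper
triangular matrices acts on the solutions by conjugating U, and L modulo upper triangular matrices;
the action preserves the diagonal of M².

Over any field, a strictly upper triangular U of square zero is B-conjugate to the 0-1 matrix of an
involution σ (`adapted_step`, `IsPt.exists_inCell`). So every point of E lies in a cell indexed by
an involution, swept out by B from the points `arcMat σ` + X with X in a linear space. Under the
trace form, the conditions on X are dual, up to a change of signs, to the tangent space of the
unipotent orbit of `arcMat σ`, and the torus adds one dimension for each arc. Hence the cell has
dimension (N² - #fixed points of σ)/2 (`two_mul_finrank_add`). This count becomes an upper bound for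
the residue field of any point of the cell (`trdeg_le_of_inCell`) and a lower bound for the generic
point of a polynomial parametrization (`le_trdeg_cellIdeal`). The closures of the cells are
irreducible, so the components of top dimension are the closures of the cells whose σ has at most
one fixed point.

It remains to see that E_π is the closure of the cell of π. In the cell of σ the diagonal of M² is
constant along arcs and zero at fixed points, and at the generic point there are no further
coincidences if σ has at most one fixed point. A point of the locus of π thus lies in the cell of π,
unless the diagonal of M² vanishes on an arc; then that arc may be missing from σ. Rotation of the
indices is a symmetry of E, though not of the splitting U + L. It brings an end of the missing arc
to the first index, where an explicit line joins the point to the cell of π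
(`evalMat_eq_zero_of_remove_arc`, `evalMat_eq_zero_of_inLoc`). -/

namespace BrauerLoop

open Matrix

/-! ### Triangular parts of matrices -/

section Triangular

variable {N : ℕ} {R : Type*} [CommRing R]

/-- The strictly upper triangular part of a matrix. -/
def up (M : Matrix (Fin N) (Fin N) R) : Matrix (Fin N) (Fin N) R :=
  Matrix.of fun i j => if i < j then M i j else 0

/-- The strictly lower triangular part of a matrix. -/
def low (M : Matrix (Fin N) (Fin N) R) : Matrix (Fin N) (Fin N) R :=
  Matrix.of fun i j => if j < i then M i j else 0

/-- The weakly upper triangular part of a matrix. -/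
def triu (M : Matrix (Fin N) (Fin N) R) : Matrix (Fin N) (Fin N) R :=
  Matrix.of fun i j => if i ≤ j then M i j else 0

lemma up_apply (M : Matrix (Fin N) (Fin N) R) (i j) : up M i j = if i < j then M i j else 0 := rfl

lemma low_apply (M : Matrix (Fin N) (Fin N) R) (i j) : low M i j = if j < i then M i j else 0 := rfl

lemma triu_apply (M : Matrix (Fin N) (Fin N) R) (i j) :
    triu M i j = if i ≤ j then M i j else 0 := rfl

/-- Strictly upper triangular matrices. -/
def IsStrictUpper (M : Matrix (Fin N) (Fin N) R) : Prop := ∀ i j, j ≤ i → M i j = 0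

lemma isUpperTriangular_iff {M : Matrix (Fin N) (Fin N) R} :
    M.IsUpperTriangular ↔ ∀ i j, j < i → M i j = 0 :=
  ⟨fun h _ _ hij => h hij, fun h _ _ hij => h _ _ hij⟩

lemma IsStrictUpper.isUpperTriangular {M : Matrix (Fin N) (Fin N) R} (h : IsStrictUpper M) :
    M.IsUpperTriangular := fun _ _ hij => h _ _ (le_of_lt hij)

lemma isStrictUpper_up (M : Matrix (Fin N) (Fin N) R) : IsStrictUpper (up M) :=
  fun _ _ h => if_neg (not_lt.mpr h)

lemma isUpperTriangular_triu (M : Matrix (Fin N) (Fin N) R) : (triu M).IsUpperTriangular :=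
  fun _ _ h => if_neg (not_le.mpr h)

lemma low_add_triu (M : Matrix (Fin N) (Fin N) R) : low M + triu M = M := by
  ext i j
  by_cases h : i ≤ j
  · simp [low_apply, triu_apply, h, not_lt.mpr h]
  · simp [low_apply, triu_apply, h, not_le.mp h]

lemma low_add (M M' : Matrix (Fin N) (Fin N) R) : low (M + M') = low M + low M' := by
  ext i j; by_cases h : j < i <;> simp [low_apply, h]

lemma low_smul (c : R) (M : Matrix (Fin N) (Fin N) R) : low (c • M) = c • low M := by
  ext i j; by_cases h : j < i <;> simp [low_apply, h]

lemma up_add (M M' : Matrix (Fin N) (Fin N) R) : up (M + M') = up M + up M' := by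
  ext i j; by_cases h : i < j <;> simp [up_apply, h]

lemma up_smul (c : R) (M : Matrix (Fin N) (Fin N) R) : up (c • M) = c • up M := by
  ext i j; by_cases h : i < j <;> simp [up_apply, h]

lemma triu_add (M M' : Matrix (Fin N) (Fin N) R) : triu (M + M') = triu M + triu M' := by
  ext i j; by_cases h : i ≤ j <;> simp [triu_apply, h]

lemma triu_smul (c : R) (M : Matrix (Fin N) (Fin N) R) : triu (c • M) = c • triu M := by
  ext i j; by_cases h : i ≤ j <;> simp [triu_apply, h]

lemma low_low (M : Matrix (Fin N) (Fin N) R) : low (low M) = low M := by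
  ext i j; by_cases h : j < i <;> simp [low_apply, h]

lemma low_eq_zero_iff {M : Matrix (Fin N) (Fin N) R} : low M = 0 ↔ M.IsUpperTriangular := by
  rw [isUpperTriangular_iff]
  constructor
  · intro h i j hij
    have := congrFun (congrFun h i) j
    simpa [low_apply, hij] using this
  · intro h
    ext i j
    by_cases hij : j < i
    · simp [low_apply, hij, h i j hij]
    · simp [low_apply, hij]

lemma up_low (M : Matrix (Fin N) (Fin N) R) : up (low M) = 0 := by
  ext i j
  by_cases h : i < j
  · simp [up_apply, low_apply, not_lt.mpr h.le]
  · simp [up_apply, h]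

lemma IsStrictUpper.up_eq {M : Matrix (Fin N) (Fin N) R} (h : IsStrictUpper M) : up M = M := by
  ext i j
  by_cases hij : i < j
  · simp [up_apply, hij]
  · simp [up_apply, hij, h i j (not_lt.mp hij)]

lemma IsStrictUpper.low_eq {M : Matrix (Fin N) (Fin N) R} (h : IsStrictUpper M) : low M = 0 :=
  low_eq_zero_iff.mpr h.isUpperTriangular

lemma triu_eq_self {M : Matrix (Fin N) (Fin N) R} (h : M.IsUpperTriangular) : triu M = M := by
  have := low_add_triu M
  rwa [low_eq_zero_iff.mpr h, zero_add] at this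

lemma up_add_low {M : Matrix (Fin N) (Fin N) R} (h : ∀ i, M i i = 0) : up M + low M = M := by
  ext i j
  rcases lt_trichotomy i j with hij | rfl | hij
  · simp [low_apply, up_apply, hij, hij.not_gt]
  · simp [low_apply, up_apply, h]
  · simp [low_apply, up_apply, hij, hij.not_gt]

/-- Replacing a matrix by its lower part does not change the lower part of a product with upper
triangular matrices. -/
lemma low_mul_low_mul {b c : Matrix (Fin N) (Fin N) R} (hb : b.IsUpperTriangular)
    (hc : c.IsUpperTriangular) (X : Matrix (Fin N) (Fin N) R) :
    low (b * low X * c) = low (b * X * c) := by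
  conv_rhs => rw [← low_add_triu X, mul_add, add_mul, low_add]
  rw [low_eq_zero_iff.mpr ((BlockTriangular.mul hb (isUpperTriangular_triu X)).mul hc), add_zero]

lemma low_mul_low {b : Matrix (Fin N) (Fin N) R} (hb : b.IsUpperTriangular)
    (X : Matrix (Fin N) (Fin N) R) : low (b * low X) = low (b * X) := by
  simpa using low_mul_low_mul hb (blockTriangular_one) X

lemma low_low_mul {c : Matrix (Fin N) (Fin N) R} (hc : c.IsUpperTriangular)
    (X : Matrix (Fin N) (Fin N) R) : low (low X * c) = low (X * c) := by
  simpa using low_mul_low_mul (blockTriangular_one) hc X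

lemma mul_apply_self_of_isUpperTriangular {a b : Matrix (Fin N) (Fin N) R}
    (ha : a.IsUpperTriangular) (hb : b.IsUpperTriangular) (i : Fin N) :
    (a * b) i i = a i i * b i i := by
  rw [Matrix.mul_apply, Finset.sum_eq_single i]
  · intro j _ hj
    rcases lt_or_gt_of_ne hj with h | h
    · rw [ha h, zero_mul]
    · rw [hb h, mul_zero]
  · simp

lemma IsStrictUpper.mul {a b : Matrix (Fin N) (Fin N) R}
    (ha : IsStrictUpper a) (hb : b.IsUpperTriangular) : IsStrictUpper (a * b) := by
  intro i j hij
  rw [Matrix.mul_apply]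
  refine Finset.sum_eq_zero fun k _ => ?_
  by_cases h : k ≤ i
  · rw [ha i k h, zero_mul]
  · rw [hb (lt_of_le_of_lt hij (not_le.mp h)), mul_zero]

lemma IsStrictUpper.mul_left {a b : Matrix (Fin N) (Fin N) R}
    (ha : a.IsUpperTriangular) (hb : IsStrictUpper b) : IsStrictUpper (a * b) := by
  intro i j hij
  rw [Matrix.mul_apply]
  refine Finset.sum_eq_zero fun k _ => ?_
  by_cases h : k < i
  · rw [ha h, zero_mul]
  · rw [hb k j (hij.trans (not_lt.mp h)), mul_zero]

end Triangular

/-! ### The equations of E in terms of triangular parts -/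

section Points

variable {N : ℕ} {R : Type*} [CommRing R]

/-- `M` is an `R`-valued point of the Brauer loop scheme. -/
def IsPt (M : Matrix (Fin N) (Fin N) R) : Prop := (∀ i, M i i = 0) ∧ cycMul M M = 0

lemma cycMul_apply_of_lt {M : Matrix (Fin N) (Fin N) R} (h : ∀ i, M i i = 0) {i k : Fin N}
    (hik : i < k) : cycMul M M i k = (up M * up M) i k := by
  simp only [cycMul, Matrix.of_apply, Matrix.mul_apply, up_apply]
  refine Finset.sum_congr rfl fun j _ => ?_
  by_cases h1 : i < j
  · by_cases h2 : j < k
    · rw [if_pos, if_pos h1, if_pos h2]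
      exact ⟨Or.inl ⟨h1.le, h2.le⟩, fun e => absurd e hik.ne⟩
    · rw [if_neg h2, mul_zero]
      by_cases h3 : j = k
      · subst h3; simp [h]
      · rw [if_neg]
        rintro ⟨h4, -⟩
        omega
  · rw [if_neg h1, zero_mul]
    by_cases h3 : i = j
    · subst h3; simp [h]
    · rw [if_neg]
      rintro ⟨h4, -⟩
      omega

lemma cycMul_apply_of_gt {M : Matrix (Fin N) (Fin N) R} (h : ∀ i, M i i = 0) {i k : Fin N}
    (hik : k < i) : cycMul M M i k = (up M * low M + low M * up M) i k := by
  simp only [cycMul, Matrix.of_apply, Matrix.add_apply, Matrix.mul_apply, up_apply, low_apply,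
    ← Finset.sum_add_distrib]
  refine Finset.sum_congr rfl fun j _ => ?_
  rcases lt_trichotomy i j with h1 | rfl | h1
  · rw [if_pos ⟨by omega, fun e => absurd e hik.ne'⟩, if_pos h1, if_pos (hik.trans h1),
      if_neg h1.not_gt]
    simp
  · simp [h]
  · rcases lt_trichotomy j k with h2 | rfl | h2
    · rw [if_pos ⟨by omega, fun e => absurd e hik.ne'⟩, if_pos h1, if_pos h2, if_neg h1.not_gt]
      simp
    · simp [h]
    · rw [if_neg, if_neg h1.not_gt, if_neg h2.not_gt]
      · simp
      · rintro ⟨h4, -⟩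
        omega

lemma cycMul_apply_self {M : Matrix (Fin N) (Fin N) R} (h : ∀ i, M i i = 0) (i : Fin N) :
    cycMul M M i i = 0 := by
  simp only [cycMul, Matrix.of_apply]
  refine Finset.sum_eq_zero fun j _ => ?_
  by_cases hj : i = j
  · subst hj; simp [h]
  · rw [if_neg]
    rintro ⟨-, h4⟩
    exact hj (h4 rfl).1

/-- For i < k the cyclic condition on j means i ≤ j ≤ k, which is the product of upper parts. For i
> k it means j ≥ i or j ≤ k, where exactly one factor is upper and the other lower. On the diagonal
only j = i survives and contributes zero. -/
lemma isPt_iff {M : Matrix (Fin N) (Fin N) R} :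
    IsPt M ↔ (∀ i, M i i = 0) ∧ up M * up M = 0 ∧ low (up M * low M + low M * up M) = 0 := by
  refine and_congr_right fun h => ?_
  constructor
  · intro h0
    constructor
    · ext i k
      by_cases hik : i < k
      · rw [← cycMul_apply_of_lt h hik, h0]
      · exact (isStrictUpper_up M).mul (isStrictUpper_up M).isUpperTriangular i k (not_lt.mp hik)
    · ext i k
      by_cases hik : k < i
      · rw [low_apply, if_pos hik, ← cycMul_apply_of_gt h hik, h0]
      · rw [low_apply, if_neg hik]; rfl
  · rintro ⟨h1, h2⟩
    ext i k
    rcases lt_trichotomy i k with hik | rfl | hik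
    · rw [cycMul_apply_of_lt h hik, h1]
    · rw [cycMul_apply_self h]; rfl
    · rw [cycMul_apply_of_gt h hik]
      have := congrFun (congrFun h2 i) k
      rwa [low_apply, if_pos hik] at this

lemma IsPt.smul {M : Matrix (Fin N) (Fin N) R} (h : IsPt M) (c : R) : IsPt (c • M) := by
  refine ⟨fun i => by simp [h.1], ?_⟩
  have : cycMul (c • M) (c • M) = (c * c) • cycMul M M := by
    ext i k
    simp only [cycMul, Matrix.of_apply, Matrix.smul_apply, smul_eq_mul, Finset.mul_sum]
    refine Finset.sum_congr rfl fun j _ => ?_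
    split_ifs <;> ring
  rw [this, h.2, smul_zero]

/-- `U + L` is a point as soon as `U` squares to zero and `U L + L U` has no lower part. -/
lemma isPt_add {U L : Matrix (Fin N) (Fin N) R} (hU : IsStrictUpper U) (hL : low L = L)
    (hUU : U * U = 0) (hUL : low (U * L + L * U) = 0) :
    IsPt (U + L) ∧ up (U + L) = U ∧ low (U + L) = L := by
  have h1 : up (U + L) = U := by rw [up_add, hU.up_eq, ← hL, up_low, add_zero]
  have h2 : low (U + L) = L := by rw [low_add, hU.low_eq, hL, zero_add]
  refine ⟨isPt_iff.mpr ⟨fun i => ?_, by rw [h1, hUU], by rw [h1, h2, hUL]⟩, h1, h2⟩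
  rw [Matrix.add_apply, hU i i le_rfl, ← hL, low_apply, if_neg (lt_irrefl i), add_zero]

lemma IsPt.eq_add {M : Matrix (Fin N) (Fin N) R} (h : IsPt M) : up M + low M = M := up_add_low h.1

/-- The diagonal of the square of a point. -/
lemma mul_self_apply_self {U L : Matrix (Fin N) (Fin N) R} (hUU : U * U = 0) (hL : low L = L)
    (i : Fin N) : ((U + L) * (U + L)) i i = (U * L + L * U) i i := by
  have : (L * L) i i = 0 := by
    rw [Matrix.mul_apply]
    refine Finset.sum_eq_zero fun j _ => ?_
    rw [← hL, low_apply, low_apply]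
    by_cases h : j < i
    · rw [if_neg h.not_gt, mul_zero]
    · rw [if_neg h, zero_mul]
  rw [add_mul, mul_add, mul_add, hUU]
  simp only [Matrix.add_apply, this, Matrix.zero_apply]
  ring

end Points

/-! ### The action of invertible upper triangular matrices -/

section Conj

variable {N : ℕ} {K : Type*} [Field K]

lemma isUpperTriangular_inv {b : Matrix (Fin N) (Fin N) K} (hb : b.IsUpperTriangular)
    (hd : b.det ≠ 0) : (b⁻¹).IsUpperTriangular := by
  have : Invertible b := b.invertibleOfIsUnitDet (isUnit_iff_ne_zero.mpr hd)
  exact blockTriangular_inv_of_blockTriangular hb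

/-- The action of invertible upper triangular matrices on points. -/
noncomputable def conjB (b M : Matrix (Fin N) (Fin N) K) : Matrix (Fin N) (Fin N) K :=
  b * up M * b⁻¹ + low (b * low M * b⁻¹)

variable {b : Matrix (Fin N) (Fin N) K}

lemma isStrictUpper_conj (hb : b.IsUpperTriangular) (hd : b.det ≠ 0)
    {A : Matrix (Fin N) (Fin N) K} (hA : IsStrictUpper A) : IsStrictUpper (b * A * b⁻¹) :=
  (IsStrictUpper.mul_left hb hA).mul (isUpperTriangular_inv hb hd)

lemma conj_mul_conj (hd : b.det ≠ 0) (X Y : Matrix (Fin N) (Fin N) K) :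
    (b * X * b⁻¹) * (b * Y * b⁻¹) = b * (X * Y) * b⁻¹ := by
  have : b⁻¹ * b = 1 := nonsing_inv_mul b (isUnit_iff_ne_zero.mpr hd)
  calc _ = b * X * (b⁻¹ * b) * Y * b⁻¹ := by simp only [Matrix.mul_assoc]
    _ = _ := by rw [this]; simp only [Matrix.mul_assoc, Matrix.one_mul]

/-- Truncating to the lower part commutes with multiplication by upper triangular matrices, modulo
upper triangular matrices. The truncation inside can therefore be dropped, which leaves a conjugate
of AX + XA. -/
lemma low_conj_anticomm (hb : b.IsUpperTriangular) (hd : b.det ≠ 0)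
    {A X : Matrix (Fin N) (Fin N) K} (hA : IsStrictUpper A) (hAX : low (A * X + X * A) = 0) :
    low (b * A * b⁻¹ * low (b * X * b⁻¹) + low (b * X * b⁻¹) * (b * A * b⁻¹)) = 0 := by
  have hU := (isStrictUpper_conj hb hd hA).isUpperTriangular
  rw [low_add, low_mul_low hU, low_low_mul hU, conj_mul_conj hd, conj_mul_conj hd, ← low_add,
    ← add_mul, ← mul_add, ← low_mul_low_mul hb (isUpperTriangular_inv hb hd), hAX]
  ext i j; simp [low_apply]

lemma isPt_conj (hb : b.IsUpperTriangular) (hd : b.det ≠ 0)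
    {A X : Matrix (Fin N) (Fin N) K} (hA : IsStrictUpper A) (hAA : A * A = 0)
    (hAX : low (A * X + X * A) = 0) :
    IsPt (b * A * b⁻¹ + low (b * X * b⁻¹)) ∧
      up (b * A * b⁻¹ + low (b * X * b⁻¹)) = b * A * b⁻¹ ∧
      low (b * A * b⁻¹ + low (b * X * b⁻¹)) = low (b * X * b⁻¹) := by
  refine isPt_add (isStrictUpper_conj hb hd hA) (low_low _) ?_ (low_conj_anticomm hb hd hA hAX)
  rw [conj_mul_conj hd, hAA]; simp

lemma IsPt.conjB_spec {M : Matrix (Fin N) (Fin N) K} (h : IsPt M) (hb : b.IsUpperTriangular)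
    (hd : b.det ≠ 0) : IsPt (conjB b M) ∧ up (conjB b M) = b * up M * b⁻¹ ∧
      low (conjB b M) = low (b * low M * b⁻¹) :=
  have h' := isPt_iff.mp h
  isPt_conj hb hd (isStrictUpper_up M) h'.2.1 h'.2.2

lemma IsPt.conjB_conjB_inv {M : Matrix (Fin N) (Fin N) K} (h : IsPt M) (hb : b.IsUpperTriangular)
    (hd : b.det ≠ 0) : conjB b (conjB b⁻¹ M) = M := by
  have hu : IsUnit b.det := isUnit_iff_ne_zero.mpr hd
  have hb' := isUpperTriangular_inv hb hd
  have hd' : (b⁻¹).det ≠ 0 := by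
    rw [det_nonsing_inv]; simpa using hd
  obtain ⟨-, h1, h2⟩ := h.conjB_spec hb' hd'
  have key : ∀ X : Matrix (Fin N) (Fin N) K, b * (b⁻¹ * X * b⁻¹⁻¹) * b⁻¹ = X := by
    intro X
    rw [nonsing_inv_nonsing_inv _ hu]
    calc _ = (b * b⁻¹) * X * (b * b⁻¹) := by simp only [Matrix.mul_assoc]
      _ = X := by rw [mul_nonsing_inv b hu]; simp
  rw [conjB, h1, h2, low_mul_low_mul hb hb', key, key, low_low, h.eq_add]

lemma conj_apply_self (hb : b.IsUpperTriangular) (hd : b.det ≠ 0)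
    {C : Matrix (Fin N) (Fin N) K} (hC : C.IsUpperTriangular) (i : Fin N) :
    (b * C * b⁻¹) i i = C i i := by
  have hb' := isUpperTriangular_inv hb hd
  rw [mul_apply_self_of_isUpperTriangular (hb.mul hC) hb',
    mul_apply_self_of_isUpperTriangular hb hC]
  have : (b * b⁻¹) i i = 1 := by
    rw [mul_nonsing_inv b (isUnit_iff_ne_zero.mpr hd)]; simp
  rw [mul_apply_self_of_isUpperTriangular hb hb'] at this
  linear_combination C i i * this

/-- The diagonal of the square is invariant under conjugation. -/
lemma conj_mul_self_apply_self (hb : b.IsUpperTriangular) (hd : b.det ≠ 0)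
    {A X : Matrix (Fin N) (Fin N) K} (hA : IsStrictUpper A) (hAA : A * A = 0)
    (hAX : low (A * X + X * A) = 0) (i : Fin N) :
    ((b * A * b⁻¹ + low (b * X * b⁻¹)) * (b * A * b⁻¹ + low (b * X * b⁻¹))) i i =
      (A * X + X * A) i i := by
  have hU := isStrictUpper_conj hb hd hA
  rw [mul_self_apply_self (by rw [conj_mul_conj hd, hAA]; simp) (low_low _)]
  have h0 : ((b * A * b⁻¹) * (b * X * b⁻¹) + (b * X * b⁻¹) * (b * A * b⁻¹)) i i =
      (A * X + X * A) i i := by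
    rw [conj_mul_conj hd, conj_mul_conj hd, ← add_mul, ← mul_add,
      conj_apply_self hb hd (low_eq_zero_iff.mp hAX)]
  rw [← h0]
  set Y := b * X * b⁻¹
  set U := b * A * b⁻¹
  -- The part of `Y` lost by truncation is upper triangular, so its products with the strictly upper
  -- `U` have zero diagonal.
  have hY : Y = low Y + triu Y := (low_add_triu Y).symm
  have hz1 : (U * triu Y) i i = 0 := hU.mul (isUpperTriangular_triu Y) i i le_rfl
  have hz2 : (triu Y * U) i i = 0 := IsStrictUpper.mul_left (isUpperTriangular_triu Y) hU i i le_rfl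
  conv_rhs => rw [hY]
  simp only [mul_add, add_mul, Matrix.add_apply, hz1, hz2]
  simp

end Conj

end BrauerLoop

namespace BrauerLoop

open Matrix

/-! ### Involutions as square-zero matrices, and their cells -/

section Arc

variable {N : ℕ} {R : Type*} [CommRing R]

/-- The strictly upper triangular matrix of an involution. -/
def arcMat (R : Type*) [CommRing R] (σ : Equiv.Perm (Fin N)) : Matrix (Fin N) (Fin N) R :=
  Matrix.of fun i j => if i < j ∧ σ j = i then 1 else 0

lemma isStrictUpper_arcMat (σ : Equiv.Perm (Fin N)) : IsStrictUpper (arcMat R σ) :=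
  fun _ _ h => if_neg fun h' => absurd h'.1 (not_lt.mpr h)

lemma arcMat_map {S : Type*} [CommRing S] (f : R →+* S) (σ : Equiv.Perm (Fin N)) :
    (arcMat R σ).map f = arcMat S σ := by
  ext i j
  simp only [arcMat, Matrix.map_apply, Matrix.of_apply]
  split_ifs <;> simp

variable {σ : Equiv.Perm (Fin N)}

lemma mul_arcMat_apply (X : Matrix (Fin N) (Fin N) R) (i j : Fin N) :
    (X * arcMat R σ) i j = if σ j < j then X i (σ j) else 0 := by
  rw [Matrix.mul_apply, Finset.sum_eq_single (σ j)]
  · simp [arcMat]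
  · intro k _ hk
    simp only [arcMat, Matrix.of_apply]
    rw [if_neg fun h => hk h.2.symm, mul_zero]
  · simp

lemma arcMat_mul_apply (hσ : Function.Involutive σ) (X : Matrix (Fin N) (Fin N) R) (i j : Fin N) :
    (arcMat R σ * X) i j = if i < σ i then X (σ i) j else 0 := by
  rw [Matrix.mul_apply, Finset.sum_eq_single (σ i)]
  · simp [arcMat, hσ i]
  · intro k _ hk
    simp only [arcMat, Matrix.of_apply]
    rw [if_neg, zero_mul]
    rintro ⟨-, h⟩
    exact hk (by rw [← h, hσ k])
  · simp

lemma arcMat_mul_self (hσ : Function.Involutive σ) : arcMat R σ * arcMat R σ = 0 := by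
  ext i j
  rw [arcMat_mul_apply hσ]
  split_ifs with h
  · simp only [arcMat, Matrix.of_apply, Matrix.zero_apply]
    rw [if_neg]
    rintro ⟨h1, h2⟩
    have : j = i := by rw [← hσ j, h2, hσ i]
    subst this
    exact absurd h1 h.not_gt
  · rfl

/-- A point lies in the cell of `σ` if its upper part is conjugate to the matrix of `σ` under the
group of invertible upper triangular matrices. -/
def InCell (σ : Equiv.Perm (Fin N)) (M : Matrix (Fin N) (Fin N) R) : Prop :=
  IsPt M ∧ ∃ b : Matrix (Fin N) (Fin N) R,
    b.IsUpperTriangular ∧ b.det ≠ 0 ∧ up M * b = b * arcMat R σ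

end Arc

/-! ### Normal form of strictly upper triangular matrices of square zero -/

section Classification

variable {N : ℕ} {K : Type*} [Field K]

lemma det_ne_zero_of_isUpperTriangular {b : Matrix (Fin N) (Fin N) K} (hb : b.IsUpperTriangular)
    (hd : ∀ i, b i i ≠ 0) : b.det ≠ 0 := by
  rw [det_of_isUpperTriangular hb]
  exact Finset.prod_ne_zero_iff.mpr fun i _ => hd i

lemma sum_smul_eq_mulVec (v : Fin N → Fin N → K) (c : Fin N → K) :
    ∑ i, c i • v i = (Matrix.of fun i j => v j i) *ᵥ c := by
  ext i
  simp [Matrix.mulVec, dotProduct, mul_comm]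

/-- One step of the construction of an adapted basis. -/
lemma adapted_step {U : Matrix (Fin N) (Fin N) K} (hU : IsStrictUpper U) (hUU : U * U = 0)
    (k : Fin N) (v : Fin N → Fin N → K) (σ : Equiv.Perm (Fin N)) (hσ : Function.Involutive σ)
    (hk : ∀ j, k ≤ j → σ j = j) (hv : ∀ j, v j j ≠ 0) (hv' : ∀ j i, j < i → v j i = 0)
    (hUv : ∀ j < k, U *ᵥ v j = if σ j < j then v (σ j) else 0) :
    ∃ (v' : Fin N → Fin N → K) (σ' : Equiv.Perm (Fin N)), Function.Involutive σ' ∧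
      (∀ j, k < j → σ' j = j) ∧ (∀ j, v' j j ≠ 0) ∧ (∀ j i, j < i → v' j i = 0) ∧
      (∀ j ≤ k, U *ᵥ v' j = if σ' j < j then v' (σ' j) else 0) := by
  classical
  set b : Matrix (Fin N) (Fin N) K := Matrix.of fun i j => v j i with hbdef
  have hb : b.IsUpperTriangular := fun i j hij => hv' j i hij
  have hd : b.det ≠ 0 := det_ne_zero_of_isUpperTriangular hb hv
  have hu : IsUnit b.det := isUnit_iff_ne_zero.mpr hd
  have hb' := isUpperTriangular_inv hb hd
  have hindep : ∀ d : Fin N → K, ∑ i, d i • v i = 0 → d = 0 := by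
    intro d h
    rw [sum_smul_eq_mulVec] at h
    have := congrArg (fun x => b⁻¹ *ᵥ x) h
    simpa [Matrix.mulVec_mulVec, nonsing_inv_mul b hu, ← hbdef] using this
  have hlt : ∀ i, σ i < i → i < k := by
    intro i hi
    by_contra h
    rw [hk i (not_lt.mp h)] at hi
    exact lt_irrefl _ hi
  have hlt' : ∀ i, σ i < i → σ i < k := fun i hi => hi.trans (hlt i hi)
  set y := U *ᵥ v k with hy
  have hy0 : ∀ i, k ≤ i → y i = 0 := by
    intro i hi
    simp only [hy, Matrix.mulVec, dotProduct]
    refine Finset.sum_eq_zero fun j _ => ?_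
    by_cases h : j ≤ i
    · rw [hU i j h, zero_mul]
    · rw [hv' k j (lt_of_le_of_lt hi (not_le.mp h)), mul_zero]
  set c := b⁻¹ *ᵥ y with hc
  have hc0 : ∀ i, k ≤ i → c i = 0 := by
    intro i hi
    simp only [hc, Matrix.mulVec, dotProduct]
    refine Finset.sum_eq_zero fun j _ => ?_
    by_cases h : j < i
    · rw [hb' h, zero_mul]
    · rw [hy0 j (hi.trans (not_lt.mp h)), mul_zero]
  have hyc : y = ∑ i, c i • v i := by
    rw [sum_smul_eq_mulVec, ← hbdef, hc, Matrix.mulVec_mulVec, mul_nonsing_inv b hu,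
      Matrix.one_mulVec]
  have hUsum : ∀ d : Fin N → K, (∀ i, k ≤ i → d i = 0) →
      U *ᵥ (∑ i, d i • v i) = ∑ m, (if m < σ m then d (σ m) else 0) • v m := by
    intro d hd0
    rw [Matrix.mulVec_sum, ← Equiv.sum_comp σ (fun m => (if m < σ m then d (σ m) else 0) • v m)]
    refine Finset.sum_congr rfl fun i _ => ?_
    rw [Matrix.mulVec_smul, hσ i]
    by_cases hi : i < k
    · rw [hUv i hi]
      split_ifs <;> simp
    · rw [hd0 i (not_lt.mp hi)]; simp
  -- `U` sends the vector at the right end of an arc to the one at the left end and kills the other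
  -- `v i` with i < k. Since U y = U² v_k = 0, no right end occurs in `y`.
  have hc1 : ∀ i, σ i < i → c i = 0 := by
    intro i hi
    have h1 : U *ᵥ y = 0 := by rw [hy, Matrix.mulVec_mulVec, hUU, Matrix.zero_mulVec]
    rw [hyc, hUsum c hc0] at h1
    have := congrFun (hindep _ h1) (σ i)
    simpa [hσ i, hi] using this
  -- Left ends occurring in `y` are images of right ends, and subtracting these removes them. Only
  -- fixed points of `σ` survive in `U x`.
  set x := v k - ∑ i, (if σ i < i then c (σ i) else 0) • v i with hx
  set d : Fin N → K := fun m => if σ m = m then c m else 0 with hddef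
  have hUx : U *ᵥ x = ∑ m, d m • v m := by
    rw [hx, Matrix.mulVec_sub, hUsum, ← hy, hyc, ← Finset.sum_sub_distrib]
    · refine Finset.sum_congr rfl fun m _ => ?_
      rw [← sub_smul]
      congr 1
      simp only [hddef, hσ m]
      rcases lt_trichotomy m (σ m) with h | h | h
      · simp [h, h.ne']
      · simp [← h]
      · simp [h.not_gt, h.ne, hc1 m h]
    · intro i hi
      rw [if_neg fun h => absurd (hlt i h) (not_lt.mpr hi)]
  have hxk : ∀ i, k ≤ i → x i = v k i := by
    intro i hi
    simp only [hx, Pi.sub_apply, Finset.sum_apply, Pi.smul_apply, smul_eq_mul, sub_eq_self]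
    refine Finset.sum_eq_zero fun j _ => ?_
    by_cases h : σ j < j
    · rw [hv' j i ((hlt j h).trans_le hi), mul_zero]
    · rw [if_neg h, zero_mul]
  have hd0 : ∀ i, k ≤ i → d i = 0 := by
    intro i hi
    simp only [hddef, hc0 i hi, ite_self]
  by_cases hdz : d = 0
  · refine ⟨Function.update v k x, σ, hσ, fun j hj => hk j hj.le, fun j => ?_, fun j i hij => ?_,
      fun j hj => ?_⟩
    · by_cases h : j = k
      · subst h; simpa [hxk j le_rfl] using hv j
      · simpa [h] using hv j
    · by_cases h : j = k
      · subst h; simpa [hxk i hij.le] using hv' j i hij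
      · simpa [h] using hv' j i hij
    · rcases hj.lt_or_eq with h | rfl
      · rw [Function.update_of_ne h.ne, hUv j h]
        by_cases h' : σ j < j
        · rw [if_pos h', if_pos h', Function.update_of_ne (h'.trans h).ne]
        · rw [if_neg h', if_neg h']
      · rw [Function.update_self, hUx, hdz, hk j le_rfl, if_neg (lt_irrefl j)]
        simp
  · have hne : (Finset.univ.filter fun m => d m ≠ 0).Nonempty := by
      by_contra h
      rw [Finset.not_nonempty_iff_eq_empty, Finset.filter_eq_empty_iff] at h
      exact hdz (funext fun m => by simpa using h (Finset.mem_univ m))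
    -- With `m` the last index occurring in `w = U x`, replacing `v m` by `w` keeps the basis
    -- triangular. As `m` is fixed by `σ`, no earlier arc uses `v m`, and (m, k) becomes a new arc.
    obtain ⟨m, hm, hmax⟩ : ∃ m, d m ≠ 0 ∧ ∀ i, m < i → d i = 0 := by
      refine ⟨_, (Finset.mem_filter.mp (Finset.max'_mem _ hne)).2, fun i hi => ?_⟩
      by_contra h
      exact absurd (Finset.le_max' _ i (by simpa using h)) (not_le.mpr hi)
    have hmk : m < k := by
      by_contra h
      exact hm (hd0 m (not_lt.mp h))
    have hσm : σ m = m := by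
      by_contra h
      exact hm (if_neg h)
    have hσk : σ k = k := hk k le_rfl
    set w := ∑ i, d i • v i with hw
    have hwm : w m = d m * v m m := by
      rw [hw, Finset.sum_apply, Finset.sum_eq_single m]
      · simp
      · intro j _ hj
        rcases lt_or_gt_of_ne hj with h | h
        · simp [hv' j m h]
        · simp [hmax j h]
      · simp
    have hwi : ∀ i, m < i → w i = 0 := by
      intro i hi
      rw [hw, Finset.sum_apply]
      refine Finset.sum_eq_zero fun j _ => ?_
      by_cases h : m < j
      · simp [hmax j h]
      · simp [hv' j i (lt_of_le_of_lt (not_lt.mp h) hi)]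
    have hUw : U *ᵥ w = 0 := by
      rw [hw, hUsum d hd0]
      refine Finset.sum_eq_zero fun j _ => ?_
      by_cases h : j < σ j
      · simp [hddef, hσ j, h, h.ne]
      · simp [h]
    have hs : ∀ j, j ≠ m → j ≠ k → (Equiv.swap m k * σ) j = σ j := by
      intro j h1 h2
      rw [Equiv.Perm.mul_apply, Equiv.swap_apply_of_ne_of_ne]
      · intro h; exact h1 (by rw [← hσ j, h, hσm])
      · intro h; exact h2 (by rw [← hσ j, h, hσk])
    have hsm : (Equiv.swap m k * σ) m = k := by
      rw [Equiv.Perm.mul_apply, hσm, Equiv.swap_apply_left]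
    have hsk : (Equiv.swap m k * σ) k = m := by
      rw [Equiv.Perm.mul_apply, hσk, Equiv.swap_apply_right]
    refine ⟨Function.update (Function.update v k x) m w, Equiv.swap m k * σ, fun j => ?_,
      fun j hj => ?_, fun j => ?_, fun j i hij => ?_, fun j hj => ?_⟩
    · by_cases h1 : j = m
      · rw [h1, hsm, hsk]
      by_cases h2 : j = k
      · rw [h2, hsk, hsm]
      rw [hs j h1 h2, hs, hσ j]
      · intro h; exact h1 (by rw [← hσ j, h, hσm])
      · intro h; exact h2 (by rw [← hσ j, h, hσk])
    · rw [hs j (hmk.trans hj).ne' hj.ne', hk j hj.le]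
    · by_cases h1 : j = m
      · subst h1; simpa [hwm] using ⟨hm, hv j⟩
      by_cases h : j = k
      · subst h; simpa [h1, hxk j le_rfl] using hv j
      · simpa [h, h1] using hv j
    · by_cases h1 : j = m
      · subst h1; simpa using hwi i hij
      by_cases h : j = k
      · subst h; simpa [h1, hxk i hij.le] using hv' j i hij
      · simpa [h, h1] using hv' j i hij
    · by_cases h1 : j = m
      · rw [h1, hsm, if_neg hmk.not_gt, Function.update_self, hUw]
      by_cases h2 : j = k
      · rw [h2, hsk, if_pos hmk, Function.update_self, Function.update_of_ne hmk.ne',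
          Function.update_self, hUx]
      · rw [hs j h1 h2, Function.update_of_ne h1, Function.update_of_ne h2,
          hUv j (lt_of_le_of_ne hj h2)]
        by_cases h' : σ j < j
        · rw [if_pos h', if_pos h', Function.update_of_ne, Function.update_of_ne]
          · exact (h'.trans_le hj).ne
          · intro h; exact h1 (by rw [← hσ j, h, hσm])
        · rw [if_neg h', if_neg h']

lemma exists_adapted {U : Matrix (Fin N) (Fin N) K} (hU : IsStrictUpper U) (hUU : U * U = 0)
    (k : ℕ) (hkN : k ≤ N) :
    ∃ (v : Fin N → Fin N → K) (σ : Equiv.Perm (Fin N)), Function.Involutive σ ∧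
      (∀ j : Fin N, k ≤ j → σ j = j) ∧ (∀ j, v j j ≠ 0) ∧ (∀ j i, j < i → v j i = 0) ∧
      (∀ j : Fin N, j < k → U *ᵥ v j = if σ j < j then v (σ j) else 0) := by
  induction k with
  | zero =>
    refine ⟨fun j => Pi.single j 1, 1, fun _ => rfl, fun _ _ => rfl, fun j => by simp,
      fun j i h => by simp [h.ne'], fun j h => absurd h (Nat.not_lt_zero _)⟩
  | succ k ih =>
    obtain ⟨v, σ, h1, h2, h3, h4, h5⟩ := ih (by omega)
    obtain ⟨v', σ', g1, g2, g3, g4, g5⟩ := adapted_step hU hUU ⟨k, hkN⟩ v σ h1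
      (fun j hj => h2 j hj) h3 h4 (fun j hj => h5 j hj)
    exact ⟨v', σ', g1, fun j hj => g2 j hj, g3, g4, fun j hj => g5 j (Nat.lt_succ_iff.mp hj)⟩

/-- Every point over a field lies in the cell of some involution. -/
theorem IsPt.exists_inCell {M : Matrix (Fin N) (Fin N) K} (h : IsPt M) :
    ∃ σ : Equiv.Perm (Fin N), Function.Involutive σ ∧ InCell σ M := by
  obtain ⟨v, σ, h1, -, h3, h4, h5⟩ :=
    exists_adapted (isStrictUpper_up M) (isPt_iff.mp h).2.1 N le_rfl
  refine ⟨σ, h1, h, Matrix.of fun i j => v j i, fun i j hij => h4 j i hij, ?_, ?_⟩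
  · exact det_ne_zero_of_isUpperTriangular (fun i j hij => h4 j i hij) h3
  · ext i j
    rw [mul_arcMat_apply]
    have := congrFun (h5 j j.2) i
    simp only [Matrix.mulVec, dotProduct] at this
    simp only [Matrix.mul_apply, Matrix.of_apply, this]
    split_ifs <;> rfl

/-- A point of a cell is conjugate to a point with upper part the matrix of the involution. -/
lemma IsPt.normal_form {σ : Equiv.Perm (Fin N)} {M b : Matrix (Fin N) (Fin N) K} (hM : IsPt M)
    (hb : b.IsUpperTriangular) (hd : b.det ≠ 0) (hMb : up M * b = b * arcMat K σ) :
    low (arcMat K σ * low (b⁻¹ * low M * b) + low (b⁻¹ * low M * b) * arcMat K σ) = 0 ∧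
      M = b * arcMat K σ * b⁻¹ + low (b * low (b⁻¹ * low M * b) * b⁻¹) := by
  have hu : IsUnit b.det := isUnit_iff_ne_zero.mpr hd
  have hb' := isUpperTriangular_inv hb hd
  have hd' : (b⁻¹).det ≠ 0 := by
    rw [det_nonsing_inv]; simpa using hd
  obtain ⟨h1, h2, h3⟩ := hM.conjB_spec hb' hd'
  rw [nonsing_inv_nonsing_inv _ hu] at h2 h3
  have h4 : b⁻¹ * up M * b = arcMat K σ := by
    rw [Matrix.mul_assoc, hMb, ← Matrix.mul_assoc, nonsing_inv_mul b hu, Matrix.one_mul]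
  rw [h4] at h2
  have h6 : conjB b⁻¹ M = arcMat K σ + low (b⁻¹ * low M * b) := by rw [← h2, ← h3, h1.eq_add]
  constructor
  · have := (isPt_iff.mp h1).2.2
    rwa [h2, h3] at this
  · conv_lhs => rw [← hM.conjB_conjB_inv hb hd, conjB, h2, h3]

lemma InCell.exists_normal {σ : Equiv.Perm (Fin N)}
    {M : Matrix (Fin N) (Fin N) K} (h : InCell σ M) :
    ∃ b X : Matrix (Fin N) (Fin N) K, b.IsUpperTriangular ∧ b.det ≠ 0 ∧ low X = X ∧
      low (arcMat K σ * X + X * arcMat K σ) = 0 ∧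
      M = b * arcMat K σ * b⁻¹ + low (b * X * b⁻¹) := by
  obtain ⟨hM, b, hb, hd, hMb⟩ := h
  obtain ⟨h1, h2⟩ := hM.normal_form hb hd hMb
  exact ⟨b, _, hb, hd, low_low _, h1, h2⟩

lemma arcMat_anticomm_apply {σ : Equiv.Perm (Fin N)} (hσ : Function.Involutive σ)
    (X : Matrix (Fin N) (Fin N) K) (i j : Fin N) :
    (arcMat K σ * X + X * arcMat K σ) i j =
      (if i < σ i then X (σ i) j else 0) + if σ j < j then X i (σ j) else 0 := by
  rw [Matrix.add_apply, arcMat_mul_apply hσ, mul_arcMat_apply]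

lemma arcMat_anticomm_apply_self {σ : Equiv.Perm (Fin N)} (hσ : Function.Involutive σ)
    (X : Matrix (Fin N) (Fin N) K) (i : Fin N) :
    (arcMat K σ * X + X * arcMat K σ) i i =
      if i = σ i then 0 else X (max i (σ i)) (min i (σ i)) := by
  rw [arcMat_anticomm_apply hσ]
  rcases lt_trichotomy i (σ i) with h | h | h
  · rw [if_pos h, if_neg h.not_gt, if_neg h.ne, max_eq_right h.le, min_eq_left h.le, add_zero]
  · rw [if_pos h, ← h]; simp
  · rw [if_pos h, if_neg h.not_gt, if_neg h.ne', max_eq_left h.le, min_eq_right h.le, zero_add]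

/-- In normal form the diagonal entry at i is the entry of X at the two ends of the arc through i,
or zero if i is fixed. This is how the diagonal of M² restricts σ. -/
lemma InCell.sq_diag {σ : Equiv.Perm (Fin N)} (hσ : Function.Involutive σ)
    {M : Matrix (Fin N) (Fin N) K} (h : InCell σ M) (i : Fin N) :
    (M * M) (σ i) (σ i) = (M * M) i i ∧ (σ i = i → (M * M) i i = 0) := by
  obtain ⟨b, X, hb, hd, -, hX, hM⟩ := h.exists_normal
  have key : ∀ i, (M * M) i i = if i = σ i then 0 else X (max i (σ i)) (min i (σ i)) := by
    intro i
    rw [hM, conj_mul_self_apply_self hb hd (isStrictUpper_arcMat σ)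
      (arcMat_mul_self hσ) hX, arcMat_anticomm_apply_self hσ]
  constructor
  · rw [key, key, hσ i, max_comm, min_comm]
    by_cases h : i = σ i
    · rw [if_pos h, if_pos h.symm]
    · rw [if_neg h, if_neg fun h' => h h'.symm]
  · intro h
    rw [key, if_pos h.symm]

end Classification

end BrauerLoop

namespace BrauerLoop

open Module

/-! ### Rational coordinates on kernels, and transcendence degree from generators -/

lemma linearMap_apply_eq_sum_single {R n V : Type*} [CommRing R] [Fintype n] [DecidableEq n]
    [AddCommGroup V] [Module R V] (T : (n → R) →ₗ[R] V) (x : n → R) :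
    T x = ∑ i, x i • T (Pi.single i 1) := by
  rw [LinearMap.pi_apply_eq_sum_univ]
  refine Finset.sum_congr rfl fun i _ => ?_
  congr 2
  ext j
  simp [Pi.single_apply, eq_comm]

/-- The kernel of a linear map `T` is parametrized by some of the coordinates, in a way which is
defined over any field of definition of `T`. -/
theorem exists_coords {K n m : Type*} [Field K] [Fintype n] [Fintype m] [DecidableEq n]
    (T : (n → K) →ₗ[K] (m → K)) :
    ∃ S : Finset n, S.card + finrank K (LinearMap.range T) = Fintype.card n ∧
      (∀ c : n → K, ∃ v, T v = 0 ∧ ∀ i ∈ S, v i = c i) ∧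
      (∀ v, T v = 0 → (∀ i ∈ S, v i = 0) → v = 0) ∧
      ∀ (F : Subfield K) (x : n → K), (∀ i j, T (Pi.single i 1) j ∈ F) → (∀ j, T x j ∈ F) →
        (∀ i ∈ S, x i ∈ F) → ∀ i, x i ∈ F := by
  classical
  set w : n → m → K := fun i => T (Pi.single i 1) with hw
  have hT : ∀ x, T x = ∑ i, x i • w i := fun x => linearMap_apply_eq_sum_single T x
  have hrange : LinearMap.range T = Submodule.span K (Set.range w) := by
    apply le_antisymm
    · rintro _ ⟨x, rfl⟩
      rw [hT]
      exact Submodule.sum_mem _ fun i _ => Submodule.smul_mem _ _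
        (Submodule.subset_span ⟨i, rfl⟩)
    · rw [Submodule.span_le]
      rintro _ ⟨i, rfl⟩
      exact ⟨_, rfl⟩
  -- A maximal independent family of columns gives the pivots; the remaining indices are the free
  -- coordinates.
  obtain ⟨κ, a, ha, hspan, hli⟩ := exists_linearIndependent' K w
  have : Fintype κ := Fintype.ofInjective a ha
  set S : Finset n := (Finset.univ.image a)ᶜ with hS
  have hsum : ∀ x : n → K, T x = ∑ i ∈ S, x i • w i + ∑ k, x (a k) • w (a k) := by
    intro x
    rw [hT, ← Finset.sum_image (s := Finset.univ) (g := a) (f := fun i => x i • w i)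
      (fun _ _ _ _ h => ha h), hS, Finset.sum_compl_add_sum]
  have hmem : ∀ i, i ∉ S → ∃ k, a k = i := by
    intro i hi
    simpa [hS] using hi
  have hnot : ∀ k, a k ∉ S := fun k => by simp [hS]
  refine ⟨S, ?_, fun c => ?_, fun v hv hvS => ?_, fun F x hF hTx hxS => ?_⟩
  · have h1 : finrank K (LinearMap.range T) = Fintype.card κ := by
      rw [hrange, ← hspan, finrank_span_eq_card hli]
    rw [h1, hS, Finset.card_compl, Finset.card_image_of_injective _ ha, Finset.card_univ]
    exact Nat.sub_add_cancel (Fintype.card_le_of_injective a ha)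
  · have h1 : -∑ i ∈ S, c i • w i ∈ Submodule.span K (Set.range (w ∘ a)) := by
      rw [hspan]
      exact Submodule.neg_mem _ (Submodule.sum_mem _ fun i _ => Submodule.smul_mem _ _
        (Submodule.subset_span ⟨i, rfl⟩))
    obtain ⟨d, hd⟩ := (Submodule.mem_span_range_iff_exists_fun K).mp h1
    refine ⟨fun i => if i ∈ S then c i else ∑ k, if a k = i then d k else 0, ?_, fun i hi => ?_⟩
    · have h2 : ∀ k, (if a k ∈ S then c (a k) else ∑ k', if a k' = a k then d k' else 0) = d k := by
        intro k
        simp [hnot k, ha.eq_iff]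
      rw [hsum, Finset.sum_congr rfl fun i (hi : i ∈ S) => by rw [if_pos hi],
        Finset.sum_congr rfl fun k (_ : k ∈ Finset.univ) => by rw [h2 k]]
      have h3 : ∑ k, d k • w (a k) = -∑ i ∈ S, c i • w i := hd
      rw [h3, add_neg_cancel]
    · simp [hi]
  · rw [hsum, Finset.sum_eq_zero (s := S) (fun i hi => by rw [hvS i hi, zero_smul]), zero_add] at hv
    have := Fintype.linearIndependent_iff.mp hli _ hv
    ext i
    by_cases hi : i ∈ S
    · exact hvS i hi
    · obtain ⟨k, rfl⟩ := hmem i hi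
      exact this k
  -- The pivot columns are independent over `F` as well, so they have a left inverse with entries in
  -- `F`, which solves for the pivot coordinates.
  · set u : κ → m → F := fun k j => ⟨w (a k) j, hF _ _⟩ with hu
    have hui : LinearIndependent F u := by
      rw [Fintype.linearIndependent_iff]
      intro g hg k
      have h1 : ∑ k, (g k : K) • (w ∘ a) k = 0 := by
        ext j
        have := congrArg Subtype.val (congrFun hg j)
        simpa [hu, Finset.sum_apply] using this
      have := Fintype.linearIndependent_iff.mp hli _ h1 k
      exact_mod_cast this
    obtain ⟨g, hg⟩ := LinearMap.exists_leftInverse_of_injective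
      (Fintype.linearCombination F u) (LinearMap.ker_eq_bot.mpr
        (linearIndependent_iff_injective_fintypeLinearCombination.mp hui))
    have hgu : ∀ k k', ∑ j, ((g (Pi.single j 1) k : F) : K) * w (a k') j =
        if k = k' then 1 else 0 := by
      intro k k'
      have h1 : g (u k') = Pi.single k' 1 := by
        have := LinearMap.congr_fun hg (Pi.single k' 1)
        simpa [Fintype.linearCombination_apply_single] using this
      have h2 := congrFun (linearMap_apply_eq_sum_single g (u k')) k
      rw [h1] at h2
      have h3 := congrArg Subtype.val h2
      simp only [Finset.sum_apply, Pi.smul_apply, smul_eq_mul] at h3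
      push_cast at h3
      rw [Finset.sum_congr rfl fun j _ => mul_comm _ _]
      refine h3.symm.trans ?_
      by_cases h : k = k'
      · subst h; simp
      · simp [h]
    intro i
    by_cases hi : i ∈ S
    · exact hxS i hi
    obtain ⟨k, rfl⟩ := hmem i hi
    have h1 : x (a k) = ∑ j, ((g (Pi.single j 1) k : F) : K) *
        (T x j - ∑ i ∈ S, x i * w i j) := by
      have h2 : ∀ j, T x j - ∑ i ∈ S, x i * w i j = ∑ k', x (a k') * w (a k') j := by
        intro j
        have := congrFun (hsum x) j
        simp only [Pi.add_apply, Finset.sum_apply, Pi.smul_apply, smul_eq_mul] at this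
        rw [this]; ring
      simp only [h2, Finset.mul_sum]
      rw [Finset.sum_comm]
      have h3 : ∀ k', ∑ j, ((g (Pi.single j 1) k : F) : K) * (x (a k') * w (a k') j) =
          x (a k') * if k = k' then 1 else 0 := by
        intro k'
        rw [← hgu k k', Finset.mul_sum]
        exact Finset.sum_congr rfl fun j _ => by ring
      simp [h3]
    rw [h1]
    exact sum_mem fun j _ => mul_mem (g (Pi.single j 1) k).2 (sub_mem (hTx j)
      (sum_mem fun i hi => mul_mem (hxS i hi) (hF i j)))

/-- A field which is generated, as a field, by a set over the image of a domain has transcendence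
degree at most the cardinality of that set. -/
theorem trdeg_le_of_generate {k K : Type*} [CommRing k] [Field K] [Algebra k K]
    [IsDomain k] [FaithfulSMul k K] (S : Set K)
    (h : ∀ F : Subfield K, (∀ c : k, algebraMap k K c ∈ F) → S ⊆ F → F = ⊤) :
    Algebra.trdeg k K ≤ Cardinal.mk S := by
  set B := Algebra.adjoin k S
  -- The elements algebraic over `B` form a field containing the generators, hence everything.
  let C : Subalgebra B K := Subalgebra.algebraicClosure B K
  let F : Subfield K := { C.toSubring with
    inv_mem' := fun x hx => IsAlgebraic.inv hx }
  have hB : ∀ x ∈ B, x ∈ F := fun x hx =>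
    isAlgebraic_algebraMap (A := K) (⟨x, hx⟩ : B)
  have hF : F = ⊤ := h F (fun c => hB _ (B.algebraMap_mem c))
    (fun x hx => hB _ (Algebra.subset_adjoin hx))
  have : Algebra.IsAlgebraic B K := ⟨fun x => by
    have : x ∈ F := by rw [hF]; trivial
    exact this⟩
  exact Algebra.IsAlgebraic.trdeg_le_cardinalMk k S

end BrauerLoop

namespace BrauerLoop

open Matrix Module

/-! ### The linear space of lower parts over a given involution -/

section Proj

variable {N : ℕ} {R : Type*} [CommRing R]

/-- The projection onto the lower triangular matrices whose anticommutator with the matrix of `σ`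
has no lower part. -/
def proj (σ : Equiv.Perm (Fin N)) :
    Matrix (Fin N) (Fin N) R →ₗ[R] Matrix (Fin N) (Fin N) R where
  toFun X := Matrix.of fun k l =>
    if l < k then
      -- The equations either couple two entries as X k l + X (σ k) (σ l) = 0, or say that one entry
      -- vanishes. In a coupled pair the entry whose two indices are right ends is kept as the free
      -- one, and the other is its negative.
      if σ k < k ∧ σ l < l ∧ l < σ k then X k l
      else if k < σ k ∧ l < σ l ∧ σ l < k then -X (σ k) (σ l)
      else if (σ k < k ∧ l < σ k ∧ l ≤ σ l) ∨ (l < σ l ∧ σ l < k ∧ σ k ≤ k) then 0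
      else X k l
    else 0
  map_add' X Y := by
    ext k l
    simp only [Matrix.of_apply, Matrix.add_apply]
    split_ifs <;> ring
  map_smul' c X := by
    ext k l
    simp only [Matrix.of_apply, Matrix.smul_apply, smul_eq_mul, RingHom.id_apply]
    split_ifs <;> ring

lemma proj_apply (σ : Equiv.Perm (Fin N)) (X : Matrix (Fin N) (Fin N) R) (k l : Fin N) :
    proj σ X k l = if l < k then
      if σ k < k ∧ σ l < l ∧ l < σ k then X k l
      else if k < σ k ∧ l < σ l ∧ σ l < k then -X (σ k) (σ l)
      else if (σ k < k ∧ l < σ k ∧ l ≤ σ l) ∨ (l < σ l ∧ σ l < k ∧ σ k ≤ k) then 0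
      else X k l
    else 0 := rfl

lemma proj_map {S : Type*} [CommRing S] (f : R →+* S) (σ : Equiv.Perm (Fin N))
    (X : Matrix (Fin N) (Fin N) R) : (proj σ X).map f = proj σ (X.map f) := by
  ext k l
  simp only [Matrix.map_apply, proj_apply]
  split_ifs <;> simp

lemma low_proj (σ : Equiv.Perm (Fin N)) (X : Matrix (Fin N) (Fin N) R) :
    low (proj σ X) = proj σ X := by
  ext k l
  rw [low_apply, proj_apply]
  split_ifs <;> rfl

variable {σ : Equiv.Perm (Fin N)}

lemma low_arcMat_anticomm_apply (hσ : Function.Involutive σ) (X : Matrix (Fin N) (Fin N) R)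
    (i j : Fin N) : low (arcMat R σ * X + X * arcMat R σ) i j =
      if j < i then (if i < σ i then X (σ i) j else 0) + (if σ j < j then X i (σ j) else 0)
      else 0 := by
  rw [low_apply, Matrix.add_apply, arcMat_mul_apply hσ, mul_arcMat_apply]

lemma low_anticomm_proj (hσ : Function.Involutive σ) (X : Matrix (Fin N) (Fin N) R) :
    low (arcMat R σ * proj σ X + proj σ X * arcMat R σ) = 0 := by
  ext i j
  rw [low_arcMat_anticomm_apply hσ, Matrix.zero_apply]
  by_cases hij : j < i
  swap
  · rw [if_neg hij]
  rw [if_pos hij]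
  by_cases h1 : i < σ i <;> by_cases h2 : σ j < j
  · rw [if_pos h1, if_pos h2, proj_apply, proj_apply, hσ i, hσ j, if_pos (hij.trans h1),
      if_pos ⟨h1, h2, hij⟩, if_pos (h2.trans hij), if_neg fun h => absurd h.1 h1.not_gt,
      if_pos ⟨h1, h2, hij⟩, add_neg_cancel]
  · rw [if_pos h1, if_neg h2, proj_apply, hσ i, if_pos (hij.trans h1), if_neg fun h => h2 h.2.1,
      if_neg fun h => absurd h.1 h1.not_gt, if_pos (Or.inl ⟨h1, hij, not_lt.mp h2⟩), add_zero]
  · rw [if_neg h1, if_pos h2, proj_apply, hσ j, if_pos (h2.trans hij),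
      if_neg fun h => absurd h.2.1 h2.not_gt, if_neg fun h => h1 h.1,
      if_pos (Or.inr ⟨h2, hij, not_lt.mp h1⟩), add_zero]
  · rw [if_neg h1, if_neg h2, add_zero]

/-- Each case of `proj` that alters an entry is forced by one equation: that at (k, σ l) or at (σ k,
l). With `low_anticomm_proj` this identifies the solution space with the range of an explicit
projection defined over the integers. -/
lemma proj_eq_self (hσ : Function.Involutive σ) {X : Matrix (Fin N) (Fin N) R} (hX : low X = X)
    (h : low (arcMat R σ * X + X * arcMat R σ) = 0) : proj σ X = X := by
  have key : ∀ i j, j < i →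
      (if i < σ i then X (σ i) j else 0) + (if σ j < j then X i (σ j) else 0) = 0 := by
    intro i j hij
    have := congrFun (congrFun h i) j
    rwa [low_arcMat_anticomm_apply hσ, if_pos hij] at this
  ext k l
  rw [proj_apply]
  by_cases hkl : l < k
  swap
  · rw [if_neg hkl, ← hX, low_apply, if_neg hkl]
  rw [if_pos hkl]
  split_ifs with h1 h2 h3
  · rfl
  · have := key k (σ l) h2.2.2
    rw [hσ l, if_pos h2.1, if_pos h2.2.1] at this
    exact neg_eq_of_add_eq_zero_right this
  · rcases h3 with ⟨h4, h5, h6⟩ | ⟨h4, h5, h6⟩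
    · have := key (σ k) l h5
      rw [hσ k, if_pos h4, if_neg h6.not_gt, add_zero] at this
      exact this.symm
    · have := key k (σ l) h5
      rw [hσ l, if_neg h6.not_gt, if_pos h4, zero_add] at this
      exact this.symm
  · rfl

lemma proj_proj (hσ : Function.Involutive σ) (X : Matrix (Fin N) (Fin N) R) :
    proj σ (proj σ X) = proj σ X :=
  proj_eq_self hσ (low_proj σ X) (low_anticomm_proj hσ X)

lemma proj_single_mem (σ : Equiv.Perm (Fin N)) {K : Type*} [Field K] (F : Subfield K)
    {X : Matrix (Fin N) (Fin N) K} (hX : ∀ i j, X i j ∈ F) (k l : Fin N) : proj σ X k l ∈ F := by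
  rw [proj_apply]
  split_ifs
  · exact hX _ _
  · exact neg_mem (hX _ _)
  · exact zero_mem _
  · exact hX _ _
  · exact zero_mem _

end Proj

/-! ### The dimension of a cell -/

section Rank

variable {N : ℕ} {K : Type*} [Field K]

/-- The matrices supported on a set of positions. -/
def suppMat (K : Type*) [Field K] (s : Finset (Fin N × Fin N)) :
    Submodule K (Matrix (Fin N) (Fin N) K) where
  carrier := {X | ∀ i j, (i, j) ∉ s → X i j = 0}
  add_mem' := fun hX hY i j h => by simp [hX i j h, hY i j h]
  zero_mem' := fun _ _ _ => rfl
  smul_mem' := fun c X hX i j h => by simp [hX i j h]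

lemma finrank_suppMat (s : Finset (Fin N × Fin N)) : finrank K (suppMat K s) = s.card := by
  classical
  let e : suppMat K s ≃ₗ[K] (s → K) :=
    { toFun := fun X p => X.1 p.1.1 p.1.2
      map_add' := fun X Y => rfl
      map_smul' := fun c X => rfl
      invFun := fun f => ⟨Matrix.of fun i j => if h : (i, j) ∈ s then f ⟨(i, j), h⟩ else 0,
        fun i j h => by simp [h]⟩
      left_inv := fun X => by
        ext i j
        by_cases h : (i, j) ∈ s
        · simp [h]
        · simp [h, X.2 i j h]
      right_inv := fun f => by
        ext p
        simp }
  rw [e.finrank_eq]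
  simp

/-- The lower part of the anticommutator with the matrix of `σ`, on lower triangular matrices. -/
def antiLow (K : Type*) [Field K] (σ : Equiv.Perm (Fin N)) :
    Matrix (Fin N) (Fin N) K →ₗ[K] Matrix (Fin N) (Fin N) K where
  toFun X := low (arcMat K σ * low X + low X * arcMat K σ)
  map_add' X Y := by
    rw [← low_add, low_add X Y]
    congr 1
    noncomm_ring
  map_smul' c X := by simp [low_smul, ← smul_add]

/-- The anticommutator with the matrix of `σ`, on strictly upper triangular matrices. -/
def antiUp (K : Type*) [Field K] (σ : Equiv.Perm (Fin N)) :
    Matrix (Fin N) (Fin N) K →ₗ[K] Matrix (Fin N) (Fin N) K where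
  toFun X := arcMat K σ * up X + up X * arcMat K σ
  map_add' X Y := by
    rw [up_add X Y]
    noncomm_ring
  map_smul' c X := by simp [up_smul, ← smul_add]

/-- The commutator with the matrix of `σ`, on strictly upper triangular matrices. -/
def adUp (K : Type*) [Field K] (σ : Equiv.Perm (Fin N)) :
    Matrix (Fin N) (Fin N) K →ₗ[K] Matrix (Fin N) (Fin N) K where
  toFun X := arcMat K σ * up X - up X * arcMat K σ
  map_add' X Y := by
    rw [up_add X Y]
    noncomm_ring
  map_smul' c X := by simp [up_smul, ← smul_sub]

/-- The commutator with the matrix of `σ`, on upper triangular matrices. -/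
def adTriu (K : Type*) [Field K] (σ : Equiv.Perm (Fin N)) :
    Matrix (Fin N) (Fin N) K →ₗ[K] Matrix (Fin N) (Fin N) K where
  toFun X := arcMat K σ * triu X - triu X * arcMat K σ
  map_add' X Y := by
    rw [triu_add X Y]
    noncomm_ring
  map_smul' c X := by simp [triu_smul, ← smul_sub]

/-- The positions below the diagonal. -/
def lowPos (N : ℕ) : Finset (Fin N × Fin N) := Finset.univ.filter fun p => p.2 < p.1

/-- The positions of the nonzero entries of the matrix of `σ`. -/
def arcPos (σ : Equiv.Perm (Fin N)) : Finset (Fin N × Fin N) :=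
  Finset.univ.filter fun p => p.1 < p.2 ∧ σ p.2 = p.1

variable {σ : Equiv.Perm (Fin N)}

lemma finrank_antiLow_add_finrank_proj (hσ : Function.Involutive σ) :
    finrank K (LinearMap.range (antiLow K σ)) +
      finrank K (LinearMap.range (proj σ : Matrix (Fin N) (Fin N) K →ₗ[K] _)) =
      (lowPos N).card := by
  have hlow : ∀ X : Matrix (Fin N) (Fin N) K, X ∈ suppMat K (lowPos N) ↔ low X = X := by
    intro X
    constructor
    · intro h
      ext i j
      rw [low_apply]
      split_ifs with hij
      · rfl
      · exact (h i j (by simpa [lowPos] using hij)).symm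
    · intro h i j hij
      rw [← h, low_apply, if_neg (by simpa [lowPos] using hij)]
  have h1 : LinearMap.range ((antiLow K σ).domRestrict (suppMat K (lowPos N))) =
      LinearMap.range (antiLow K σ) := by
    apply le_antisymm
    · rintro _ ⟨X, rfl⟩
      exact ⟨X.1, rfl⟩
    · rintro _ ⟨X, rfl⟩
      refine ⟨⟨low X, (hlow _).mpr (low_low X)⟩, ?_⟩
      simp [antiLow, low_low]
  have h2 : (LinearMap.ker ((antiLow K σ).domRestrict (suppMat K (lowPos N)))).map
      (suppMat K (lowPos N)).subtype = LinearMap.range (proj σ) := by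
    apply le_antisymm
    · rintro _ ⟨⟨X, hX⟩, hX', rfl⟩
      have hX1 := (hlow X).mp hX
      have hX2 : low (arcMat K σ * low X + low X * arcMat K σ) = 0 := hX'
      rw [hX1] at hX2
      exact ⟨X, proj_eq_self hσ hX1 hX2⟩
    · rintro _ ⟨X, rfl⟩
      refine ⟨⟨proj σ X, (hlow _).mpr (low_proj σ X)⟩, ?_, rfl⟩
      have := low_anticomm_proj hσ X
      simpa [antiLow, low_proj] using this
  have h3 := LinearMap.finrank_range_add_finrank_ker
    ((antiLow K σ).domRestrict (suppMat K (lowPos N)))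
  rw [h1, finrank_suppMat, ← Submodule.finrank_map_subtype_eq, h2] at h3
  exact h3

lemma trace_mul_low (V Y : Matrix (Fin N) (Fin N) K) :
    (V * low Y).trace = (up V * Y).trace := by
  simp only [Matrix.trace, Matrix.diag_apply, Matrix.mul_apply, low_apply, up_apply]
  refine Finset.sum_congr rfl fun i _ => Finset.sum_congr rfl fun j _ => ?_
  split_ifs <;> simp

/-- The lower and the upper anticommutator maps are transposes of each other. -/
lemma finrank_antiLow_eq_finrank_antiUp :
    finrank K (LinearMap.range (antiLow K σ)) = finrank K (LinearMap.range (antiUp K σ)) := by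
  let Φ : Matrix (Fin N) (Fin N) K →ₗ[K] Dual K (Matrix (Fin N) (Fin N) K) :=
    LinearMap.mk₂ K (fun V X => (V * X).trace)
      (fun _ _ _ => by rw [add_mul, Matrix.trace_add]) (fun _ _ _ => by simp)
      (fun _ _ _ => by rw [mul_add, Matrix.trace_add]) (fun _ _ _ => by simp)
  have hΦ : Function.Injective Φ := by
    intro V V' h
    exact Matrix.ext_iff_trace_mul_right.mpr fun X => LinearMap.congr_fun h X
  have hΦ' : Function.Surjective Φ :=
    (LinearMap.injective_iff_surjective_of_finrank_eq_finrank
      (Subspace.dual_finrank_eq).symm).mp hΦ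
  have hcomm : (antiLow K σ).dualMap ∘ₗ Φ = Φ ∘ₗ antiUp K σ := by
    refine LinearMap.ext fun V => LinearMap.ext fun X => ?_
    change (V * low (arcMat K σ * low X + low X * arcMat K σ)).trace =
      ((arcMat K σ * up V + up V * arcMat K σ) * X).trace
    -- Against a strictly upper triangular matrix, the trace form sees only the lower part of `X`.
    have hst : IsStrictUpper (arcMat K σ * up V + up V * arcMat K σ) := by
      have ha := isStrictUpper_arcMat (R := K) σ
      have hv := isStrictUpper_up V
      intro i j hij
      rw [Matrix.add_apply, ha.mul hv.isUpperTriangular i j hij,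
        hv.mul ha.isUpperTriangular i j hij, add_zero]
    have h1 : ((arcMat K σ * up V + up V * arcMat K σ) * X).trace =
        ((arcMat K σ * up V + up V * arcMat K σ) * low X).trace := by
      rw [trace_mul_low, hst.up_eq]
    have h2 : (up V * (low X * arcMat K σ)).trace = (arcMat K σ * up V * low X).trace := by
      rw [← Matrix.mul_assoc, Matrix.trace_mul_comm, ← Matrix.mul_assoc]
    rw [trace_mul_low, h1, mul_add, add_mul, Matrix.trace_add, Matrix.trace_add, h2,
      ← Matrix.mul_assoc, add_comm]
  rw [← LinearMap.finrank_range_dualMap_eq_finrank_range (antiLow K σ),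
    ← LinearMap.range_comp_of_range_eq_top (antiLow K σ).dualMap (LinearMap.range_eq_top.mpr hΦ'),
    hcomm, LinearMap.range_comp]
  exact (Submodule.equivMapOfInjective Φ hΦ _).finrank_eq.symm

/-- Changing the signs of the rows at the left ends of the arcs exchanges commutators and
anticommutators. -/
lemma finrank_antiUp_eq_finrank_adUp (hσ : Function.Involutive σ) :
    finrank K (LinearMap.range (antiUp K σ)) = finrank K (LinearMap.range (adUp K σ)) := by
  set ε : Fin N → K := fun i => if i < σ i then -1 else 1 with hε
  have hεε : Matrix.diagonal ε * Matrix.diagonal ε = 1 := by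
    rw [Matrix.diagonal_mul_diagonal, ← Matrix.diagonal_one]
    congr 1
    ext i
    simp only [hε]
    split_ifs <;> ring
  have hinj : Function.Injective (LinearMap.mulLeft K (Matrix.diagonal ε)) := by
    intro X Y h
    have h' : Matrix.diagonal ε * X = Matrix.diagonal ε * Y := h
    rw [← Matrix.one_mul X, ← hεε, Matrix.mul_assoc, h', ← Matrix.mul_assoc, hεε, Matrix.one_mul]
  have hsurj : Function.Surjective (LinearMap.mulLeft K (Matrix.diagonal ε)) := fun X =>
    ⟨Matrix.diagonal ε * X, by
      change Matrix.diagonal ε * (Matrix.diagonal ε * X) = X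
      rw [← Matrix.mul_assoc, hεε, Matrix.one_mul]⟩
  have hcomm : antiUp K σ ∘ₗ LinearMap.mulLeft K (Matrix.diagonal ε) =
      -(LinearMap.mulLeft K (Matrix.diagonal ε) ∘ₗ adUp K σ) := by
    refine LinearMap.ext fun V => ?_
    change arcMat K σ * up (Matrix.diagonal ε * V) + up (Matrix.diagonal ε * V) * arcMat K σ =
      -(Matrix.diagonal ε * (arcMat K σ * up V - up V * arcMat K σ))
    have h1 : up (Matrix.diagonal ε * V) = Matrix.diagonal ε * up V := by
      ext i j
      simp only [up_apply, Matrix.diagonal_mul]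
      split_ifs <;> simp
    -- The row of a nonzero entry is a left end, with sign -1, and its column a right end, with sign
    -- 1.
    have h2 : arcMat K σ * Matrix.diagonal ε = -(Matrix.diagonal ε * arcMat K σ) := by
      ext i j
      rw [Matrix.mul_diagonal, Matrix.neg_apply, Matrix.diagonal_mul]
      simp only [arcMat, Matrix.of_apply, hε]
      by_cases h : i < j ∧ σ j = i
      · have hi : σ i = j := by rw [← h.2, hσ]
        rw [if_pos h, hi, h.2, if_pos h.1, if_neg h.1.not_gt]
        ring
      · rw [if_neg h]; ring
    rw [h1, ← Matrix.mul_assoc, h2]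
    simp only [Matrix.neg_mul, mul_sub, Matrix.mul_assoc]
    abel
  rw [← LinearMap.range_comp_of_range_eq_top (antiUp K σ) (LinearMap.range_eq_top.mpr hsurj),
    hcomm, LinearMap.range_neg, LinearMap.range_comp]
  exact (Submodule.equivMapOfInjective _ hinj _).finrank_eq.symm

/-- Commutators with diagonal matrices fill exactly the positions of the arcs. Commutators with
strictly upper matrices vanish there, since such an entry is a difference of two diagonal entries.
-/
lemma finrank_adTriu (hσ : Function.Involutive σ) :
    finrank K (LinearMap.range (adTriu K σ)) =
      finrank K (LinearMap.range (adUp K σ)) + (arcPos σ).card := by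
  have hone : ∀ X : Matrix (Fin N) (Fin N) K, ∀ i j,
      adTriu K σ X i j = (if i < σ i then triu X (σ i) j else 0) -
        if σ j < j then triu X i (σ j) else 0 := by
    intro X i j
    change (arcMat K σ * triu X - triu X * arcMat K σ) i j = _
    rw [Matrix.sub_apply, arcMat_mul_apply hσ, mul_arcMat_apply]
  have hdecomp : ∀ X : Matrix (Fin N) (Fin N) K, triu X = up X + Matrix.diagonal X.diag := by
    intro X
    ext i j
    rcases lt_trichotomy i j with h | rfl | h
    · simp [triu_apply, up_apply, h, h.le, h.ne]
    · simp [triu_apply, up_apply]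
    · simp [triu_apply, up_apply, h.not_gt, h.not_ge, h.ne']
  have hup : ∀ X : Matrix (Fin N) (Fin N) K, triu (up X) = up X := fun X =>
    triu_eq_self (isStrictUpper_up X).isUpperTriangular
  have hdiag : ∀ d : Fin N → K, triu (Matrix.diagonal d) = Matrix.diagonal d := by
    intro d
    refine triu_eq_self fun i j h => Matrix.diagonal_apply_ne _ (ne_of_gt h)
  have hdiagapply : ∀ (d : Fin N → K) i j, adTriu K σ (Matrix.diagonal d) i j =
      if i < j ∧ σ j = i then d j - d i else 0 := by
    intro d i j
    rw [hone, hdiag, Matrix.diagonal_apply, Matrix.diagonal_apply]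
    by_cases h : i < j ∧ σ j = i
    · have hi : σ i = j := by rw [← h.2, hσ]
      rw [if_pos h, hi, if_pos h.1, if_pos rfl, h.2, if_pos h.1, if_pos rfl]
    · rw [if_neg h]
      have e1 : ¬ (i < σ i ∧ σ i = j) := by
        rintro ⟨h1, rfl⟩
        exact h ⟨h1, hσ i⟩
      have e2 : ¬ (σ j < j ∧ i = σ j) := by
        rintro ⟨h1, rfl⟩
        exact h ⟨h1, rfl⟩
      rw [← ite_and, ← ite_and, if_neg e1, if_neg e2, sub_zero]
  have hsup : LinearMap.range (adTriu K σ) = LinearMap.range (adUp K σ) ⊔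
      suppMat K (arcPos σ) := by
    apply le_antisymm
    · rintro _ ⟨X, rfl⟩
      have : adTriu K σ X = adUp K σ X + adTriu K σ (Matrix.diagonal X.diag) := by
        change arcMat K σ * triu X - triu X * arcMat K σ =
          (arcMat K σ * up X - up X * arcMat K σ) + (arcMat K σ * triu _ - triu _ * arcMat K σ)
        rw [hdiag, hdecomp X]
        noncomm_ring
      rw [this]
      refine Submodule.add_mem_sup ⟨X, rfl⟩ fun i j h => ?_
      rw [hdiagapply, if_neg (by simpa [arcPos] using h)]
    · refine sup_le ?_ fun Y hY => ?_
      · rintro _ ⟨X, rfl⟩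
        refine ⟨up X, ?_⟩
        change arcMat K σ * triu (up X) - triu (up X) * arcMat K σ = _
        rw [hup]
        rfl
      · refine ⟨Matrix.diagonal fun j => if σ j < j then Y (σ j) j else 0, ?_⟩
        ext i j
        rw [hdiagapply]
        split_ifs with h1 h2 h3 h3
        · have hi : σ i = j := by rw [← h1.2, hσ]
          rw [hi] at h3
          exact absurd h3 h1.1.not_gt
        · rw [h1.2, sub_zero]
        · rw [h1.2] at h2; exact absurd h1.1 h2
        · rw [h1.2] at h2; exact absurd h1.1 h2
        · exact (hY i j (by simpa [arcPos] using h1)).symm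
  have hdisj : LinearMap.range (adUp K σ) ⊓ suppMat K (arcPos σ) = ⊥ := by
    rw [Submodule.eq_bot_iff]
    rintro _ ⟨⟨X, rfl⟩, h⟩
    ext i j
    by_cases hij : (i, j) ∈ arcPos σ
    · simp only [arcPos, Finset.mem_filter, Finset.mem_univ, true_and] at hij
      have hi : σ i = j := by rw [← hij.2, hσ]
      change (arcMat K σ * up X - up X * arcMat K σ) i j = 0
      rw [Matrix.sub_apply, arcMat_mul_apply hσ, mul_arcMat_apply, hi, hij.2, if_pos hij.1,
        if_pos hij.1, up_apply, up_apply, if_neg (lt_irrefl _), if_neg (lt_irrefl _), sub_zero]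
    · exact h i j hij
  have := Submodule.finrank_sup_add_finrank_inf_eq (LinearMap.range (adUp K σ))
    (suppMat K (arcPos σ))
  rw [hdisj, ← hsup, finrank_bot, add_zero, finrank_suppMat] at this
  exact this

lemma two_mul_card_lowPos : 2 * (lowPos N).card + N = N * N := by
  have h1 : (Finset.univ.filter fun p : Fin N × Fin N => p.1 < p.2).card = (lowPos N).card := by
    refine Finset.card_bij' (fun p _ => p.swap) (fun p _ => p.swap) ?_ ?_ ?_ ?_ <;>
      simp [lowPos]
  have h2 : (Finset.univ.filter fun p : Fin N × Fin N => p.1 = p.2).card = N := by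
    conv_rhs => rw [← Fintype.card_fin N, ← Finset.card_univ]
    refine Finset.card_bij' (fun p _ => p.1) (fun i _ => (i, i)) ?_ ?_ ?_ ?_ <;> simp
  have h3 := Finset.card_filter_add_card_filter_not (s := (Finset.univ : Finset (Fin N × Fin N)))
    (fun p => p.1 < p.2)
  have h4 := Finset.card_filter_add_card_filter_not
    (s := (Finset.univ : Finset (Fin N × Fin N)).filter fun p => ¬ p.1 < p.2)
    (fun p => p.1 = p.2)
  rw [Finset.filter_filter, Finset.filter_filter] at h4
  have h5 : (Finset.univ.filter fun p : Fin N × Fin N => ¬ p.1 < p.2 ∧ p.1 = p.2) =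
      Finset.univ.filter fun p : Fin N × Fin N => p.1 = p.2 := by
    ext p; simp; omega
  have h6 : (Finset.univ.filter fun p : Fin N × Fin N => ¬ p.1 < p.2 ∧ ¬ p.1 = p.2) =
      lowPos N := by
    ext p; simp [lowPos]; omega
  rw [h5, h6, h2] at h4
  simp only [Finset.card_univ, Fintype.card_prod, Fintype.card_fin, h1] at h3
  omega

lemma two_mul_card_arcPos (hσ : Function.Involutive σ) :
    2 * (arcPos σ).card + (Function.fixedPoints σ).ncard = N := by
  have h1 : (arcPos σ).card = (Finset.univ.filter fun i : Fin N => i < σ i).card := by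
    refine Finset.card_bij' (fun p _ => p.1) (fun i _ => (i, σ i)) ?_ ?_ ?_ ?_
    · rintro ⟨i, j⟩ h
      simp only [arcPos, Finset.mem_filter, Finset.mem_univ, true_and] at h ⊢
      rw [← h.2, hσ, h.2]; exact h.1
    · intro i h
      simpa [arcPos, hσ i] using h
    · rintro ⟨i, j⟩ h
      simp only [arcPos, Finset.mem_filter, Finset.mem_univ, true_and] at h ⊢
      rw [← h.2, hσ]
    · intro i h; rfl
  have h2 : (Finset.univ.filter fun i : Fin N => σ i < i).card =
      (Finset.univ.filter fun i : Fin N => i < σ i).card := by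
    refine Finset.card_bij' (fun i _ => σ i) (fun i _ => σ i) ?_ ?_ ?_ ?_ <;> simp [hσ _]
  have h3 : (Function.fixedPoints σ).ncard =
      (Finset.univ.filter fun i : Fin N => σ i = i).card := by
    rw [← Set.ncard_coe_finset]
    congr 1
    ext i
    simp [Function.mem_fixedPoints, Function.IsFixedPt]
  have h4 := Finset.card_filter_add_card_filter_not (s := (Finset.univ : Finset (Fin N)))
    (fun i => i < σ i)
  have h5 := Finset.card_filter_add_card_filter_not
    (s := (Finset.univ : Finset (Fin N)).filter fun i => ¬ i < σ i) (fun i => σ i = i)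
  rw [Finset.filter_filter, Finset.filter_filter] at h5
  have h6 : (Finset.univ.filter fun i : Fin N => ¬ i < σ i ∧ σ i = i) =
      Finset.univ.filter fun i : Fin N => σ i = i := by
    ext p; simp; intro h; exact h.le
  have h7 : (Finset.univ.filter fun i : Fin N => ¬ i < σ i ∧ ¬ σ i = i) =
      Finset.univ.filter fun i : Fin N => σ i < i := by
    ext p; simp; exact ⟨fun h => lt_of_le_of_ne h.1 h.2, fun h => ⟨h.le, h.ne⟩⟩
  rw [h6, h7] at h5
  rw [Finset.card_univ, Fintype.card_fin] at h4
  omega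

/-- The dimension count for the cell of `σ`. -/
theorem two_mul_finrank_add (hσ : Function.Involutive σ) :
    2 * (finrank K (LinearMap.range (adTriu K σ)) +
      finrank K (LinearMap.range (proj σ : Matrix (Fin N) (Fin N) K →ₗ[K] _))) +
      (Function.fixedPoints σ).ncard = N * N := by
  -- The rank r of `antiLow` cancels: the fibre contributes N(N-1)/2 - r, and the orbit r plus the
  -- number of arcs.
  have h1 := finrank_antiLow_add_finrank_proj (K := K) hσ
  have h2 := finrank_antiLow_eq_finrank_antiUp (K := K) (σ := σ)
  have h3 := finrank_antiUp_eq_finrank_adUp (K := K) hσ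
  have h4 := finrank_adTriu (K := K) hσ
  have h5 := two_mul_card_lowPos (N := N)
  have h6 := two_mul_card_arcPos hσ
  omega

end Rank

end BrauerLoop

namespace BrauerLoop

open Matrix Module

/-! ### Rational choices in kernels of maps of matrices -/

section Coords

variable {N : ℕ} {K : Type*} [Field K]

/-- `exists_coords` for linear maps between spaces of matrices. -/
theorem exists_coords_matrix (T : Matrix (Fin N) (Fin N) K →ₗ[K] Matrix (Fin N) (Fin N) K) :
    ∃ S : Finset (Fin N × Fin N), S.card + finrank K (LinearMap.range T) = N * N ∧
      (∀ c : Matrix (Fin N) (Fin N) K, ∃ v, T v = 0 ∧ ∀ p ∈ S, v p.1 p.2 = c p.1 p.2) ∧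
      (∀ v, T v = 0 → (∀ p ∈ S, v p.1 p.2 = 0) → v = 0) ∧
      ∀ (F : Subfield K) (x : Matrix (Fin N) (Fin N) K),
        (∀ X : Matrix (Fin N) (Fin N) K, (∀ i j, X i j ∈ F) → ∀ i j, T X i j ∈ F) →
        (∀ i j, T x i j ∈ F) → (∀ p ∈ S, x p.1 p.2 ∈ F) → ∀ i j, x i j ∈ F := by
  classical
  let e : (Fin N × Fin N → K) ≃ₗ[K] Matrix (Fin N) (Fin N) K := LinearEquiv.curry K K _ _
  have he : ∀ f i j, e f i j = f (i, j) := fun _ _ _ => rfl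
  have he' : ∀ X p, e.symm X p = X p.1 p.2 := fun _ _ => rfl
  obtain ⟨S, h1, h2, h3, h4⟩ := exists_coords (e.symm.toLinearMap ∘ₗ T ∘ₗ e.toLinearMap)
  have hT : ∀ f, (e.symm.toLinearMap ∘ₗ T ∘ₗ e.toLinearMap) f = e.symm (T (e f)) := fun _ => rfl
  refine ⟨S, ?_, fun c => ?_, fun v hv hvS => ?_, fun F x hF hTx hxS i j => ?_⟩
  · have : finrank K (LinearMap.range (e.symm.toLinearMap ∘ₗ T ∘ₗ e.toLinearMap)) =
        finrank K (LinearMap.range T) := by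
      rw [LinearMap.range_comp, LinearMap.range_comp_of_range_eq_top _ e.range]
      exact LinearEquiv.finrank_map_eq e.symm _
    rw [this] at h1
    simpa using h1
  · obtain ⟨v, hv, hvS⟩ := h2 (e.symm c)
    rw [hT, LinearEquiv.map_eq_zero_iff] at hv
    exact ⟨e v, hv, fun p hp => hvS p hp⟩
  · have := h3 (e.symm v) (by rw [hT]; simp [hv]) (fun p hp => hvS p hp)
    simpa using this
  · refine h4 F (e.symm x) (fun p q => ?_) (fun p => ?_) hxS (i, j)
    · rw [hT, he']
      refine hF _ (fun i j => ?_) _ _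
      rw [he, Pi.single_apply]
      split_ifs
      · exact one_mem _
      · exact zero_mem _
    · rw [hT, he', e.apply_symm_apply]
      exact hTx _ _

/-- If the kernel of `T` contains a matrix with prescribed coordinates nonzero, then it contains
one whose coordinates in `S` lie in the infinite subfield `k`. -/
theorem exists_ker_rational {k : Type*} [Field k] [Infinite k] [Algebra k K]
    (T : Matrix (Fin N) (Fin N) K →ₗ[K] Matrix (Fin N) (Fin N) K) (S : Finset (Fin N × Fin N))
    (hex : ∀ c : Matrix (Fin N) (Fin N) K, ∃ v, T v = 0 ∧ ∀ p ∈ S, v p.1 p.2 = c p.1 p.2)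
    (huniq : ∀ v, T v = 0 → (∀ p ∈ S, v p.1 p.2 = 0) → v = 0)
    (v₀ : Matrix (Fin N) (Fin N) K) (hv₀ : T v₀ = 0) (hd : ∀ i, v₀ i i ≠ 0) :
    ∃ v, T v = 0 ∧ (∀ p ∈ S, ∃ c : k, v p.1 p.2 = algebraMap k K c) ∧ ∀ i, v i i ≠ 0 := by
  classical
  let ρ : LinearMap.ker T →ₗ[K] (S → K) :=
    { toFun := fun v p => v.1 p.1.1 p.1.2
      map_add' := fun _ _ => rfl
      map_smul' := fun _ _ => rfl }
  have hρ : Function.Bijective ρ := by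
    constructor
    · rw [← LinearMap.ker_eq_bot, LinearMap.ker_eq_bot']
      rintro ⟨v, hv⟩ h
      exact Subtype.ext (huniq v hv fun p hp => congrFun h ⟨p, hp⟩)
    · intro c
      obtain ⟨v, hv, hvS⟩ := hex (Matrix.of fun i j => if h : (i, j) ∈ S then c ⟨(i, j), h⟩ else 0)
      refine ⟨⟨v, hv⟩, funext fun p => ?_⟩
      change v p.1.1 p.1.2 = _
      rw [hvS p.1 p.2]
      simp
  let e := LinearEquiv.ofBijective ρ hρ
  have he : ∀ c (p : S), (e.symm c).1 p.1.1 p.1.2 = c p := fun c p =>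
    congrFun (e.apply_symm_apply c) p
  -- The k-rational choices of free coordinates for which the i-th diagonal entry vanishes. This
  -- subspace is proper because of `v₀`, and finitely many proper subspaces do not cover a space
  -- over an infinite field.
  let H : Fin N → Submodule k (S → k) := fun i =>
    LinearMap.ker ({
      toFun := fun c => (e.symm fun p => algebraMap k K (c p)).1 i i
      map_add' := fun c d => by
        have : (fun p => algebraMap k K ((c + d) p)) =
          (fun p => algebraMap k K (c p)) + fun p => algebraMap k K (d p) := by
            ext; simp
        rw [this, map_add]; rfl
      map_smul' := fun a c => by
        have : (fun p => algebraMap k K ((a • c) p)) =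
          algebraMap k K a • fun p => algebraMap k K (c p) := by
            ext; simp
        rw [this, map_smul, Algebra.smul_def]; rfl } : (S → k) →ₗ[k] K)
  have hH : ∀ i, H i ≠ ⊤ := by
    intro i hi
    have h1 : ∀ p : S, (e.symm (Pi.single p 1)).1 i i = 0 := by
      intro p
      have h2 : (Pi.single p 1 : S → k) ∈ H i := by rw [hi]; trivial
      have h3 : (e.symm fun q => algebraMap k K ((Pi.single p 1 : S → k) q)).1 i i = 0 := h2
      have h4 : (fun q => algebraMap k K ((Pi.single p 1 : S → k) q)) = Pi.single p 1 := by
        ext q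
        by_cases hq : q = p
        · subst hq; simp
        · simp [hq]
      rwa [h4] at h3
    let φ : (S → K) →ₗ[K] K :=
      { toFun := fun c => (e.symm c).1 i i
        map_add' := fun c d => by rw [map_add]; rfl
        map_smul' := fun a c => by rw [map_smul]; rfl }
    have h5 : φ (e ⟨v₀, hv₀⟩) = 0 := by
      rw [linearMap_apply_eq_sum_single]
      refine Finset.sum_eq_zero fun p _ => ?_
      rw [show φ (Pi.single p 1) = 0 from h1 p, smul_zero]
    have h6 : φ (e ⟨v₀, hv₀⟩) = v₀ i i := by
      change (e.symm (e ⟨v₀, hv₀⟩)).1 i i = _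
      rw [e.symm_apply_apply]
    exact hd i (h6 ▸ h5)
  have hcov : ⋃ i, (H i : Set (S → k)) ≠ Set.univ := by
    intro h
    obtain ⟨i, hi⟩ := Subspace.exists_eq_top_of_iUnion_eq_univ h
    exact hH i hi
  obtain ⟨c, hc⟩ := (Set.ne_univ_iff_exists_notMem _).mp hcov
  simp only [Set.mem_iUnion, not_exists] at hc
  refine ⟨(e.symm fun p => algebraMap k K (c p)).1, (e.symm fun p => algebraMap k K (c p)).2,
    fun p hp => ⟨c ⟨p, hp⟩, he _ ⟨p, hp⟩⟩, fun i h => hc i h⟩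

end Coords

section Subfield

variable {N : ℕ} {K : Type*} [Field K] {F : Subfield K}

lemma mul_mem_subfield {X Y : Matrix (Fin N) (Fin N) K} (hX : ∀ i j, X i j ∈ F)
    (hY : ∀ i j, Y i j ∈ F) (i j) : (X * Y) i j ∈ F := by
  rw [Matrix.mul_apply]
  exact sum_mem fun k _ => mul_mem (hX _ _) (hY _ _)

lemma low_mem_subfield {X : Matrix (Fin N) (Fin N) K} (hX : ∀ i j, X i j ∈ F) (i j) :
    low X i j ∈ F := by
  rw [low_apply]; split_ifs
  exacts [hX _ _, zero_mem _]

lemma up_mem_subfield {X : Matrix (Fin N) (Fin N) K} (hX : ∀ i j, X i j ∈ F) (i j) :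
    up X i j ∈ F := by
  rw [up_apply]; split_ifs
  exacts [hX _ _, zero_mem _]

lemma triu_mem_subfield {X : Matrix (Fin N) (Fin N) K} (hX : ∀ i j, X i j ∈ F) (i j) :
    triu X i j ∈ F := by
  rw [triu_apply]; split_ifs
  exacts [hX _ _, zero_mem _]

lemma arcMat_mem_subfield (σ : Equiv.Perm (Fin N)) (i j) : arcMat K σ i j ∈ F := by
  simp only [arcMat, Matrix.of_apply]; split_ifs
  exacts [one_mem _, zero_mem _]

lemma det_mem_subfield {X : Matrix (Fin N) (Fin N) K} (hX : ∀ i j, X i j ∈ F) : X.det ∈ F := by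
  rw [Matrix.det_apply']
  exact sum_mem fun τ _ => mul_mem (intCast_mem _ _) (prod_mem fun i _ => hX _ _)

lemma inv_mem_subfield {X : Matrix (Fin N) (Fin N) K} (hX : ∀ i j, X i j ∈ F) (i j) :
    X⁻¹ i j ∈ F := by
  rw [Matrix.inv_def, Matrix.smul_apply, Ring.inverse_eq_inv', smul_eq_mul]
  refine mul_mem (inv_mem (det_mem_subfield hX)) ?_
  rw [Matrix.adjugate_apply]
  refine det_mem_subfield fun k l => ?_
  rw [Matrix.updateRow_apply]
  split_ifs
  · rw [Pi.single_apply]; split_ifs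
    exacts [one_mem _, zero_mem _]
  · exact hX _ _

end Subfield

/-! ### Generators of the field of definition of a point of a cell -/

section Generators

variable {N : ℕ} {K : Type*} [Field K] {σ : Equiv.Perm (Fin N)}

/-- Upper triangular intertwiners between `U` and a multiple of the matrix of `σ`, as a kernel. -/
def intertwine (σ : Equiv.Perm (Fin N)) (μ : K) (U : Matrix (Fin N) (Fin N) K) :
    Matrix (Fin N) (Fin N) K →ₗ[K] Matrix (Fin N) (Fin N) K where
  toFun X := U * triu X - μ • (triu X * arcMat K σ)
  map_add' X Y := by
    rw [triu_add, mul_add, add_mul, smul_add]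
    abel
  map_smul' c X := by simp [triu_smul, smul_sub, smul_comm c μ]

lemma intertwine_apply (μ : K) (U X : Matrix (Fin N) (Fin N) K) :
    intertwine σ μ U X = U * triu X - μ • (triu X * arcMat K σ) := rfl

lemma triu_triu (X : Matrix (Fin N) (Fin N) K) : triu (triu X) = triu X :=
  triu_eq_self (isUpperTriangular_triu X)

/-- Substituting X = bY turns the intertwining equation into the commutator with `arcMat σ`, up to
the invertible factor μb. -/
lemma finrank_intertwine {μ : K} (hμ : μ ≠ 0) {U b : Matrix (Fin N) (Fin N) K}
    (hb : b.IsUpperTriangular) (hd : b.det ≠ 0) (hU : U * b = μ • (b * arcMat K σ)) :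
    finrank K (LinearMap.range (intertwine σ μ U)) =
      finrank K (LinearMap.range (adTriu K σ)) := by
  have hu : IsUnit b.det := isUnit_iff_ne_zero.mpr hd
  have hinj : Function.Injective (μ • LinearMap.mulLeft K b) := by
    intro X Y h
    have h1 : μ • (b * X) = μ • (b * Y) := h
    have h2 := smul_right_injective _ hμ h1
    have h3 := congrArg (fun Z => b⁻¹ * Z) h2
    simpa [← Matrix.mul_assoc, nonsing_inv_mul b hu] using h3
  have hval : ∀ Y, intertwine σ μ U (b * triu Y) = μ • (b * adTriu K σ Y) := by
    intro Y
    rw [intertwine_apply, triu_eq_self (BlockTriangular.mul hb (isUpperTriangular_triu Y))]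
    change _ = μ • (b * (arcMat K σ * triu Y - triu Y * arcMat K σ))
    rw [← Matrix.mul_assoc, hU, mul_sub, smul_sub, Matrix.smul_mul]
    simp only [Matrix.mul_assoc]
  have hrange : LinearMap.range (intertwine σ μ U) =
      (LinearMap.range (adTriu K σ)).map (μ • LinearMap.mulLeft K b) := by
    apply le_antisymm
    · rintro _ ⟨X, rfl⟩
      refine ⟨_, ⟨b⁻¹ * triu X, rfl⟩, ?_⟩
      have h1 : triu (b⁻¹ * triu X) = b⁻¹ * triu X :=
        triu_eq_self (BlockTriangular.mul (isUpperTriangular_inv hb hd) (isUpperTriangular_triu X))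
      have h2 := hval (b⁻¹ * triu X)
      rw [h1, ← Matrix.mul_assoc, mul_nonsing_inv b hu, Matrix.one_mul, intertwine_apply,
        triu_triu] at h2
      exact h2.symm
    · rintro _ ⟨_, ⟨Y, rfl⟩, rfl⟩
      exact ⟨b * triu Y, hval Y⟩
  rw [hrange]
  exact (Submodule.equivMapOfInjective _ hinj _).finrank_eq.symm

lemma intertwine_mem_subfield {F : Subfield K} {μ : K} {U : Matrix (Fin N) (Fin N) K}
    (hμ : μ ∈ F) (hU : ∀ i j, U i j ∈ F) (X : Matrix (Fin N) (Fin N) K) (hX : ∀ i j, X i j ∈ F)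
    (i j) : intertwine σ μ U X i j ∈ F := by
  rw [intertwine_apply, Matrix.sub_apply, Matrix.smul_apply, smul_eq_mul]
  exact sub_mem (mul_mem_subfield hU (triu_mem_subfield hX) _ _)
    (mul_mem hμ (mul_mem_subfield (triu_mem_subfield hX) (arcMat_mem_subfield σ) _ _))

lemma finrank_id_sub_proj (hσ : Function.Involutive σ) :
    finrank K (LinearMap.range (LinearMap.id - proj σ : Matrix (Fin N) (Fin N) K →ₗ[K] _)) +
      finrank K (LinearMap.range (proj σ : Matrix (Fin N) (Fin N) K →ₗ[K] _)) = N * N := by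
  have h1 : LinearMap.ker (LinearMap.id - proj σ : Matrix (Fin N) (Fin N) K →ₗ[K] _) =
      LinearMap.range (proj σ) := by
    apply le_antisymm
    · intro X hX
      exact ⟨X, (sub_eq_zero.mp hX).symm⟩
    · rintro _ ⟨X, rfl⟩
      exact sub_eq_zero.mpr (proj_proj hσ X).symm
  rw [← h1, LinearMap.finrank_range_add_finrank_ker, Module.finrank_matrix]
  simp

/-- The entries of a point in the cell of `σ` are rational functions of few elements. -/
theorem InCell.exists_generators {k : Type*} [Field k] [Infinite k] [Algebra k K]
    (hσ : Function.Involutive σ) {M : Matrix (Fin N) (Fin N) K} (h : InCell σ M) :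
    ∃ S : Finset K, S.card ≤ finrank K (LinearMap.range (adTriu K σ)) +
      finrank K (LinearMap.range (proj σ : Matrix (Fin N) (Fin N) K →ₗ[K] _)) ∧
      ∀ F : Subfield K, (∀ c : k, algebraMap k K c ∈ F) → (S : Set K) ⊆ F →
        ∀ i j, M i j ∈ F := by
  classical
  obtain ⟨hM, b₀, hb₀, hd₀, hMb₀⟩ := h
  obtain ⟨S₁, h1, h2, h3, h4⟩ := exists_coords_matrix (intertwine σ 1 (up M))
  have hrank := finrank_intertwine (σ := σ) one_ne_zero hb₀ hd₀ (by rw [hMb₀, one_smul])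
  have hb₀' : intertwine σ 1 (up M) b₀ = 0 := by
    rw [intertwine_apply, triu_eq_self hb₀, one_smul, hMb₀, sub_self]
  have hdiag : ∀ i, b₀ i i ≠ 0 := by
    rw [det_of_isUpperTriangular hb₀] at hd₀
    exact fun i => Finset.prod_ne_zero_iff.mp hd₀ i (Finset.mem_univ i)
  -- The conjugating matrix is ambiguous up to the stabilizer. Spending this freedom to make the
  -- free coordinates constants leaves only N² - |S₁| entries to adjoin, which is the dimension of
  -- the orbit.
  obtain ⟨v, hv, hvS, hvd⟩ := exists_ker_rational (k := k) _ S₁ h2 h3 b₀ hb₀' hdiag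
  set b := triu v with hbdef
  have hb : b.IsUpperTriangular := isUpperTriangular_triu v
  have hd : b.det ≠ 0 := det_ne_zero_of_isUpperTriangular hb fun i => by
    rw [hbdef, triu_apply, if_pos le_rfl]; exact hvd i
  have hMb : up M * b = b * arcMat K σ := by
    rw [intertwine_apply, one_smul, sub_eq_zero] at hv
    exact hv
  obtain ⟨hX, hMX⟩ := hM.normal_form hb hd hMb
  set X := low (b⁻¹ * low M * b) with hXdef
  have hPX : proj σ X = X := proj_eq_self hσ (low_low _) hX
  obtain ⟨S₂, g1, -, -, g4⟩ :=
    exists_coords_matrix (LinearMap.id - proj σ : Matrix (Fin N) (Fin N) K →ₗ[K] _)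
  have g0 := finrank_id_sub_proj (K := K) hσ
  refine ⟨S₁ᶜ.image (fun p => v p.1 p.2) ∪ S₂.image fun p => X p.1 p.2, ?_, fun F hk hS => ?_⟩
  · have c1 : (S₁ᶜ.image (fun p => v p.1 p.2)).card ≤ S₁ᶜ.card := Finset.card_image_le
    have c2 : (S₂.image (fun p => X p.1 p.2)).card ≤ S₂.card := Finset.card_image_le
    have c3 := Finset.card_union_le (S₁ᶜ.image (fun p => v p.1 p.2)) (S₂.image fun p => X p.1 p.2)
    have c4 := Finset.card_add_card_compl S₁
    simp only [Fintype.card_prod, Fintype.card_fin] at c4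
    omega
  · have hvF : ∀ i j, v i j ∈ F := by
      intro i j
      by_cases hij : (i, j) ∈ S₁
      · obtain ⟨c, hc⟩ := hvS _ hij
        have : v i j = algebraMap k K c := hc
        rw [this]; exact hk c
      · exact hS (Finset.mem_coe.mpr (Finset.mem_union_left _
          (Finset.mem_image.mpr ⟨(i, j), by simpa using hij, rfl⟩)))
    have hXF : ∀ i j, X i j ∈ F := by
      refine g4 F X (fun Y hY i j => ?_) (fun i j => ?_) fun p hp => ?_
      · exact sub_mem (hY i j) (proj_single_mem σ F hY i j)
      · rw [LinearMap.sub_apply, LinearMap.id_apply, hPX, sub_self]; exact zero_mem _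
      · exact hS (Finset.mem_coe.mpr (Finset.mem_union_right _
          (Finset.mem_image.mpr ⟨p, hp, rfl⟩)))
    have hbF : ∀ i j, b i j ∈ F := triu_mem_subfield hvF
    have hbF' := inv_mem_subfield hbF
    intro i j
    rw [hMX, Matrix.add_apply]
    exact add_mem (mul_mem_subfield (mul_mem_subfield hbF (arcMat_mem_subfield σ)) hbF' _ _)
      (low_mem_subfield (mul_mem_subfield (mul_mem_subfield hbF hXF) hbF') _ _)

end Generators

/-! ### Polynomial parametrization of the closure of a cell -/

section Param

variable {N : ℕ} {R : Type*} [CommRing R]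

/-- The polynomial parametrization of the closure of the cell of `σ`. -/
def paramMat (σ : Equiv.Perm (Fin N)) (β : Matrix (Fin N) (Fin N) R) (c : R)
    (Y : Matrix (Fin N) (Fin N) R) : Matrix (Fin N) (Fin N) R :=
  -- The adjugate keeps the formula polynomial; the scalar `c` makes up for the determinant, so that
  -- c = 1/det recovers the whole cell.
  c • (triu β * arcMat R σ * (triu β).adjugate + low (triu β * proj σ Y * (triu β).adjugate))

lemma low_map {S : Type*} [CommRing S] (f : R →+* S) (X : Matrix (Fin N) (Fin N) R) :
    (low X).map f = low (X.map f) := by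
  ext i j
  simp only [Matrix.map_apply, low_apply]
  split_ifs <;> simp

lemma triu_map {S : Type*} [CommRing S] (f : R →+* S) (X : Matrix (Fin N) (Fin N) R) :
    (triu X).map f = triu (X.map f) := by
  ext i j
  simp only [Matrix.map_apply, triu_apply]
  split_ifs <;> simp

lemma paramMat_map {S : Type*} [CommRing S] (f : R →+* S) (σ : Equiv.Perm (Fin N))
    (β : Matrix (Fin N) (Fin N) R) (c : R) (Y : Matrix (Fin N) (Fin N) R) :
    (paramMat σ β c Y).map f = paramMat σ (β.map f) (f c) (Y.map f) := by
  have h : ((triu β).adjugate).map f = (triu (β.map f)).adjugate := by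
    rw [← triu_map]
    exact RingHom.map_adjugate f (triu β)
  have h2 : ∀ A B : Matrix (Fin N) (Fin N) R, (A + B).map f = A.map f + B.map f := by
    intro A B; ext; simp
  have h3 : ∀ A : Matrix (Fin N) (Fin N) R, (c • A).map f = f c • A.map f := by
    intro A; ext; simp
  rw [paramMat, paramMat, h3, h2, low_map, Matrix.map_mul, Matrix.map_mul, Matrix.map_mul,
    Matrix.map_mul, triu_map, arcMat_map, proj_map, h]

variable {K : Type*} [Field K] {σ : Equiv.Perm (Fin N)}

lemma adjugate_eq_det_smul_inv {b : Matrix (Fin N) (Fin N) K} (hd : b.det ≠ 0) :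
    b.adjugate = b.det • b⁻¹ := by
  rw [Matrix.inv_def, Ring.inverse_eq_inv', smul_smul, mul_inv_cancel₀ hd, one_smul]

lemma paramMat_eq {β : Matrix (Fin N) (Fin N) K} (hd : (triu β).det ≠ 0) (c : K)
    (Y : Matrix (Fin N) (Fin N) K) :
    paramMat σ β c Y = (c * (triu β).det) •
      (triu β * arcMat K σ * (triu β)⁻¹ + low (triu β * proj σ Y * (triu β)⁻¹)) := by
  rw [paramMat, adjugate_eq_det_smul_inv hd, Matrix.mul_smul, Matrix.mul_smul, low_smul,
    ← smul_add, smul_smul]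

lemma isPt_paramMat (hσ : Function.Involutive σ) {β : Matrix (Fin N) (Fin N) K}
    (hd : (triu β).det ≠ 0) (c : K) (Y : Matrix (Fin N) (Fin N) K) : IsPt (paramMat σ β c Y) := by
  rw [paramMat_eq hd]
  exact (isPt_conj (isUpperTriangular_triu β) hd (isStrictUpper_arcMat σ) (arcMat_mul_self hσ)
    (low_anticomm_proj hσ Y)).1.smul _

lemma paramMat_sq_diag (hσ : Function.Involutive σ) {β : Matrix (Fin N) (Fin N) K}
    (hd : (triu β).det ≠ 0) (c : K) (Y : Matrix (Fin N) (Fin N) K) (i : Fin N) :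
    (paramMat σ β c Y * paramMat σ β c Y) i i = (c * (triu β).det) ^ 2 *
      if i = σ i then 0 else proj σ Y (max i (σ i)) (min i (σ i)) := by
  rw [paramMat_eq hd, Matrix.smul_mul, Matrix.mul_smul, smul_smul, Matrix.smul_apply,
    conj_mul_self_apply_self (isUpperTriangular_triu β) hd (isStrictUpper_arcMat σ)
    (arcMat_mul_self hσ) (low_anticomm_proj hσ Y), arcMat_anticomm_apply_self hσ, smul_eq_mul]
  ring

lemma InCell.exists_param (hσ : Function.Involutive σ) {M : Matrix (Fin N) (Fin N) K}
    (h : InCell σ M) : ∃ β c Y, M = paramMat σ β c Y := by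
  obtain ⟨b, X, hb, hd, hX, hX', rfl⟩ := h.exists_normal
  refine ⟨b, b.det⁻¹, X, ?_⟩
  rw [paramMat_eq (by rwa [triu_eq_self hb]), triu_eq_self hb, inv_mul_cancel₀ hd, one_smul,
    proj_eq_self hσ hX hX']

/-- The parameters are rational functions of the point and of few other elements. -/
theorem exists_param_generators {β : Matrix (Fin N) (Fin N) K} (hd : (triu β).det ≠ 0) {c : K}
    (hc : c ≠ 0) (hσ : Function.Involutive σ) (Y : Matrix (Fin N) (Fin N) K) :
    ∃ S : Finset K, S.card + (finrank K (LinearMap.range (adTriu K σ)) +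
      finrank K (LinearMap.range (proj σ : Matrix (Fin N) (Fin N) K →ₗ[K] _))) ≤
        N * N + N * N + 1 ∧
      ∀ F : Subfield K, (∀ i j, paramMat σ β c Y i j ∈ F) → (S : Set K) ⊆ F →
        (∀ i j, β i j ∈ F) ∧ c ∈ F ∧ ∀ i j, Y i j ∈ F := by
  classical
  set b := triu β with hbdef
  have hb : b.IsUpperTriangular := isUpperTriangular_triu β
  have hu : IsUnit b.det := isUnit_iff_ne_zero.mpr hd
  set μ := c * b.det with hμdef
  have hμ : μ ≠ 0 := mul_ne_zero hc hd
  set M := paramMat σ β c Y with hMdef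
  have hM : M = μ • (b * arcMat K σ * b⁻¹ + low (b * proj σ Y * b⁻¹)) := paramMat_eq hd c Y
  obtain ⟨-, hup, hlow⟩ := isPt_conj hb hd (isStrictUpper_arcMat σ) (arcMat_mul_self hσ)
    (low_anticomm_proj hσ Y)
  have hMup : up M = μ • (b * arcMat K σ * b⁻¹) := by rw [hM, up_smul, hup]
  have hMlow : low M = μ • low (b * proj σ Y * b⁻¹) := by rw [hM, low_smul, hlow]
  have hU : up M * b = μ • (b * arcMat K σ) := by
    rw [hMup, Matrix.smul_mul, Matrix.mul_assoc, nonsing_inv_mul b hu, Matrix.mul_one]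
  have hY : proj σ Y = μ⁻¹ • low (b⁻¹ * low M * b) := by
    rw [hMlow, Matrix.mul_smul, Matrix.smul_mul, low_smul, smul_smul, inv_mul_cancel₀ hμ, one_smul,
      low_mul_low_mul (isUpperTriangular_inv hb hd) hb]
    have : b⁻¹ * (b * proj σ Y * b⁻¹) * b = proj σ Y := by
      calc _ = (b⁻¹ * b) * proj σ Y * (b⁻¹ * b) := by simp only [Matrix.mul_assoc]
        _ = _ := by rw [nonsing_inv_mul b hu]; simp
    rw [this, low_proj]
  obtain ⟨S₁, h1, -, -, h4⟩ := exists_coords_matrix (intertwine σ μ (up M))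
  have hrank := finrank_intertwine (σ := σ) hμ hb hd hU
  obtain ⟨S₂, g1, -, -, g4⟩ :=
    exists_coords_matrix (proj σ : Matrix (Fin N) (Fin N) K →ₗ[K] _)
  -- `β` solves a linear system involving only `μ` and the point, so its free coordinates determine
  -- it. Then c = μ / det b, the projection of `Y` is read off from the lower part of the point, and
  -- `S₂` supplies what the projection forgets.
  refine ⟨{μ} ∪ (S₁.image (fun p => β p.1 p.2) ∪ S₂.image fun p => Y p.1 p.2), ?_,
    fun F hMF hS => ?_⟩
  · have c1 : (S₁.image (fun p => β p.1 p.2)).card ≤ S₁.card := Finset.card_image_le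
    have c2 : (S₂.image (fun p => Y p.1 p.2)).card ≤ S₂.card := Finset.card_image_le
    have c3 := Finset.card_union_le (S₁.image (fun p => β p.1 p.2)) (S₂.image fun p => Y p.1 p.2)
    have c4 := Finset.card_union_le {μ}
      (S₁.image (fun p => β p.1 p.2) ∪ S₂.image fun p => Y p.1 p.2)
    rw [Finset.card_singleton] at c4
    omega
  · have hμF : μ ∈ F := hS (by simp)
    have hβF : ∀ i j, β i j ∈ F := by
      refine h4 F β (intertwine_mem_subfield hμF (up_mem_subfield hMF)) (fun i j => ?_)
        fun p hp => hS ?_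
      · rw [intertwine_apply, ← hbdef, hU, sub_self]; exact zero_mem _
      · exact Finset.mem_coe.mpr (Finset.mem_union_right _ (Finset.mem_union_left _
          (Finset.mem_image.mpr ⟨p, hp, rfl⟩)))
    have hbF : ∀ i j, b i j ∈ F := triu_mem_subfield hβF
    refine ⟨hβF, ?_, ?_⟩
    · have : c = μ / b.det := by rw [hμdef, mul_div_cancel_right₀ _ hd]
      rw [this]
      exact div_mem hμF (det_mem_subfield hbF)
    · refine g4 F Y (fun X hX => proj_single_mem σ F hX) (fun i j => ?_) fun p hp => hS ?_
      · rw [hY, Matrix.smul_apply, smul_eq_mul]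
        exact mul_mem (inv_mem hμF) (low_mem_subfield (mul_mem_subfield (mul_mem_subfield
          (inv_mem_subfield hbF) (low_mem_subfield hMF)) hbF) _ _)
      · exact Finset.mem_coe.mpr (Finset.mem_union_right _ (Finset.mem_union_right _
          (Finset.mem_image.mpr ⟨p, hp, rfl⟩)))

end Param

end BrauerLoop

namespace BrauerLoop

open Matrix Module

/-! ### Krull dimension as transcendence degree -/

/-- The Krull dimension of an algebra of finite type over a field, which is a domain, is its
transcendence degree. -/
theorem exists_ringKrullDim_eq_trdeg (k A : Type*) [Field k] [CommRing A] [IsDomain A]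
    [Algebra k A] [Algebra.FiniteType k A] :
    ∃ s : ℕ, ringKrullDim A = s ∧ Algebra.trdeg k A = s := by
  obtain ⟨s, g, hinj, hint⟩ := exists_integral_inj_algHom_of_fg k A
  algebraize [g.toRingHom]
  have : Algebra.IsIntegral (MvPolynomial (Fin s) k) A := ⟨hint⟩
  have : FaithfulSMul (MvPolynomial (Fin s) k) A :=
    (faithfulSMul_iff_algebraMap_injective _ _).mpr hinj
  have : IsScalarTower k (MvPolynomial (Fin s) k) A :=
    IsScalarTower.of_algebraMap_eq fun x => (g.commutes x).symm
  have hdim : ringKrullDim (MvPolynomial (Fin s) k) = s := by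
    rw [MvPolynomial.ringKrullDim_of_isNoetherianRing]
    simp
  refine ⟨s, le_antisymm ?_ ?_, ?_⟩
  -- By Noether normalization the algebra is integral over a polynomial ring. Incomparability bounds
  -- its dimension above, and lifting chains by going up bounds it below.
  · rw [← hdim]
    refine Order.krullDim_le_of_strictMono
      (fun p : PrimeSpectrum A => PrimeSpectrum.comap (algebraMap (MvPolynomial (Fin s) k) A) p)
      fun p q hpq => ?_
    exact Ideal.IsIntegral.comap_lt_comap hpq
  · rw [← hdim]
    refine iSup_le fun l => ?_
    obtain ⟨q, hq⟩ := Algebra.IsIntegral.comap_surjective (MvPolynomial (Fin s) k) A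
      (RelSeries.head l)
    have : q.asIdeal.LiesOver (RelSeries.head l).asIdeal := ⟨by rw [← hq]; rfl⟩
    obtain ⟨L, hL, -, -⟩ := Ideal.exists_ltSeries_of_hasGoingUp l q.asIdeal
    rw [← hL]
    exact Order.LTSeries.length_le_krullDim L
  · have h1 := lift_trdeg_add_eq k (MvPolynomial (Fin s) k) A
    have h2 : Algebra.trdeg (MvPolynomial (Fin s) k) A = 0 := trdeg_eq_zero
    rw [h2, MvPolynomial.trdeg_of_isDomain] at h1
    simpa using h1.symm

end BrauerLoop

namespace BrauerLoop

open Matrix Module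

/-! ### Points of the scheme as matrices over residue fields -/

section Eval

variable {N : ℕ} {R : Type*} [CommRing R] [Algebra ℂ R]

/-- Evaluation of polynomials in the matrix entries. -/
noncomputable def evalMat (M : Matrix (Fin N) (Fin N) R) :
    MvPolynomial (Fin N × Fin N) ℂ →ₐ[ℂ] R :=
  MvPolynomial.aeval fun p => M p.1 p.2

lemma evalMat_X (M : Matrix (Fin N) (Fin N) R) (i j : Fin N) :
    evalMat M (MvPolynomial.X (i, j)) = M i j := by
  simp [evalMat]

lemma map_evalMat {S : Type*} [CommRing S] [Algebra ℂ S] (f : R →ₐ[ℂ] S)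
    (M : Matrix (Fin N) (Fin N) R) (g : MvPolynomial (Fin N × Fin N) ℂ) :
    f (evalMat M g) = evalMat (M.map f) g := by
  have : f.comp (evalMat M) = evalMat (M.map f) := by
    ext p
    simp [evalMat]
  exact AlgHom.congr_fun this g

lemma evalMat_cycMul (M : Matrix (Fin N) (Fin N) R) (i k : Fin N) :
    evalMat M (cycMul (coordMatrix N) (coordMatrix N) i k) = cycMul M M i k := by
  simp only [cycMul, Matrix.of_apply, map_sum, coordMatrix]
  refine Finset.sum_congr rfl fun j _ => ?_
  split_ifs <;> simp [evalMat_X]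

lemma brauerIdeal_le_ker_iff {M : Matrix (Fin N) (Fin N) R} :
    brauerIdeal N ≤ RingHom.ker (evalMat M) ↔ IsPt M := by
  rw [brauerIdeal, Ideal.span_le]
  constructor
  · intro h
    constructor
    · intro i
      have : coordMatrix N i i ∈ RingHom.ker (evalMat M) := h (Or.inl ⟨i, rfl⟩)
      rwa [RingHom.mem_ker, coordMatrix, Matrix.of_apply, evalMat_X] at this
    · ext i k
      have : cycMul (coordMatrix N) (coordMatrix N) i k ∈ RingHom.ker (evalMat M) :=
        h (Or.inr ⟨i, k, rfl⟩)
      rwa [RingHom.mem_ker, evalMat_cycMul] at this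
  · rintro ⟨h1, h2⟩ f (⟨i, rfl⟩ | ⟨i, k, rfl⟩)
    · simp [RingHom.mem_ker, coordMatrix, evalMat_X, h1]
    · simp [RingHom.mem_ker, evalMat_cycMul, h2]

lemma algebraMap_residueField_mk (x : PrimeSpectrum (CoordRing N))
    (f : MvPolynomial (Fin N × Fin N) ℂ) :
    algebraMap (CoordRing N) x.asIdeal.ResidueField (Ideal.Quotient.mk _ f) =
      evalMat (matrixAt x) f := by
  have : (IsScalarTower.toAlgHom ℂ (CoordRing N) x.asIdeal.ResidueField).comp
      (Ideal.Quotient.mkₐ ℂ (brauerIdeal N)) = evalMat (matrixAt x) := by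
    ext p
    simp [evalMat, matrixAt, coordMatrix]
  exact AlgHom.congr_fun this f

lemma mk_mem_asIdeal_iff (x : PrimeSpectrum (CoordRing N))
    (f : MvPolynomial (Fin N × Fin N) ℂ) :
    Ideal.Quotient.mk _ f ∈ x.asIdeal ↔ evalMat (matrixAt x) f = 0 := by
  rw [← algebraMap_residueField_mk, Ideal.algebraMap_residueField_eq_zero]

lemma isPt_matrixAt (x : PrimeSpectrum (CoordRing N)) : IsPt (matrixAt x) := by
  rw [← brauerIdeal_le_ker_iff]
  intro f hf
  rw [RingHom.mem_ker, ← algebraMap_residueField_mk, Ideal.Quotient.eq_zero_iff_mem.mpr hf, map_zero]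

end Eval

/-! ### Generic points of cells and their dimension -/

section Generic

variable {N : ℕ}

/-- The index type of the parameters. -/
abbrev ParamIdx (N : ℕ) : Type := Option ((Fin N × Fin N) ⊕ (Fin N × Fin N))

/-- The ring of parameters. -/
abbrev ParamRing (N : ℕ) : Type := MvPolynomial (ParamIdx N) ℂ

/-- The field of rational functions in the parameters. -/
abbrev ParamField (N : ℕ) : Type := FractionRing (ParamRing N)

/-- The generic upper triangular parameter. -/
noncomputable def genLeft (N : ℕ) : Matrix (Fin N) (Fin N) (ParamRing N) :=
  Matrix.of fun i j => MvPolynomial.X (some (Sum.inl (i, j)))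

/-- The generic lower triangular parameter. -/
noncomputable def genRight (N : ℕ) : Matrix (Fin N) (Fin N) (ParamRing N) :=
  Matrix.of fun i j => MvPolynomial.X (some (Sum.inr (i, j)))

/-- The generic point of the closure of the cell of `σ`. -/
noncomputable def genMat (σ : Equiv.Perm (Fin N)) : Matrix (Fin N) (Fin N) (ParamRing N) :=
  paramMat σ (genLeft N) (MvPolynomial.X none) (genRight N)

/-- The inclusion of the parameters into their field of fractions. -/
noncomputable def toField (N : ℕ) : ParamRing N →ₐ[ℂ] ParamField N :=
  IsScalarTower.toAlgHom ℂ (ParamRing N) (ParamField N)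

lemma toField_injective : Function.Injective (toField N) :=
  IsFractionRing.injective (ParamRing N) (ParamField N)

/-- The generic point of the closure of the cell of `σ`, over a field. -/
noncomputable def genMatField (σ : Equiv.Perm (Fin N)) : Matrix (Fin N) (Fin N) (ParamField N) :=
  paramMat σ ((genLeft N).map (toField N)) (toField N (MvPolynomial.X none))
    ((genRight N).map (toField N))

lemma genMat_map (σ : Equiv.Perm (Fin N)) : (genMat σ).map (toField N) = genMatField σ :=
  paramMat_map (toField N).toRingHom σ _ _ _

lemma toField_X_ne_zero (v : ParamIdx N) : toField N (MvPolynomial.X v) ≠ 0 := by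
  rw [Ne, map_eq_zero_iff _ toField_injective]
  exact MvPolynomial.X_ne_zero v

lemma det_genLeft_ne_zero : (triu ((genLeft N).map (toField N))).det ≠ 0 :=
  det_ne_zero_of_isUpperTriangular (isUpperTriangular_triu _) fun i => by
    rw [triu_apply, if_pos le_rfl]
    exact toField_X_ne_zero _

lemma isPt_genMatField {σ : Equiv.Perm (Fin N)} (hσ : Function.Involutive σ) :
    IsPt (genMatField σ) :=
  isPt_paramMat hσ det_genLeft_ne_zero _ _

lemma evalMat_genMatField_eq_zero_iff (σ : Equiv.Perm (Fin N))
    (f : MvPolynomial (Fin N × Fin N) ℂ) :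
    evalMat (genMatField σ) f = 0 ↔ evalMat (genMat σ) f = 0 := by
  rw [← genMat_map, ← map_evalMat, map_eq_zero_iff _ toField_injective]

/-- Polynomials vanishing on the generic matrix vanish on all parametrized matrices. -/
lemma evalMat_paramMat_eq_zero {σ : Equiv.Perm (Fin N)} {f : MvPolynomial (Fin N × Fin N) ℂ}
    (hf : evalMat (genMatField σ) f = 0) {R : Type*} [CommRing R] [Algebra ℂ R]
    (β : Matrix (Fin N) (Fin N) R) (c : R) (Y : Matrix (Fin N) (Fin N) R) :
    evalMat (paramMat σ β c Y) f = 0 := by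
  rw [evalMat_genMatField_eq_zero_iff] at hf
  let φ : ParamRing N →ₐ[ℂ] R := MvPolynomial.aeval fun v =>
    match v with
    | none => c
    | some (Sum.inl p) => β p.1 p.2
    | some (Sum.inr p) => Y p.1 p.2
  have h1 : (genLeft N).map φ = β := by
    ext i j; simp [genLeft, φ]
  have h2 : (genRight N).map φ = Y := by
    ext i j; simp [genRight, φ]
  have h3 : φ (MvPolynomial.X none) = c := by simp [φ]
  have h4 : (genMat σ).map φ = paramMat σ β c Y := by
    have := paramMat_map φ.toRingHom σ (genLeft N) (MvPolynomial.X none) (genRight N)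
    change (genMat σ).map φ = paramMat σ ((genLeft N).map φ) (φ (MvPolynomial.X none))
      ((genRight N).map φ) at this
    rw [this, h1, h2, h3]
  rw [← h4, ← map_evalMat, hf, map_zero]

lemma InCell.evalMat_eq_zero {σ : Equiv.Perm (Fin N)} (hσ : Function.Involutive σ)
    {f : MvPolynomial (Fin N × Fin N) ℂ} (hf : evalMat (genMatField σ) f = 0)
    {K : Type*} [Field K] [Algebra ℂ K] {M : Matrix (Fin N) (Fin N) K} (hM : InCell σ M) :
    evalMat M f = 0 := by
  obtain ⟨β, c, Y, rfl⟩ := hM.exists_param hσ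
  exact evalMat_paramMat_eq_zero hf β c Y

/-- The prime ideal of the closure of the cell of `σ`. -/
noncomputable def cellIdeal (σ : Equiv.Perm (Fin N)) : Ideal (CoordRing N) :=
  (RingHom.ker (evalMat (genMatField σ))).map (Ideal.Quotient.mk (brauerIdeal N))

variable {σ : Equiv.Perm (Fin N)}

lemma mk_mem_cellIdeal_iff (hσ : Function.Involutive σ) (f : MvPolynomial (Fin N × Fin N) ℂ) :
    Ideal.Quotient.mk _ f ∈ cellIdeal σ ↔ evalMat (genMatField σ) f = 0 := by
  rw [cellIdeal, Ideal.mem_quotient_iff_mem (brauerIdeal_le_ker_iff.mpr (isPt_genMatField hσ)),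
    RingHom.mem_ker]

lemma isPrime_cellIdeal (hσ : Function.Involutive σ) : (cellIdeal σ).IsPrime := by
  have : (RingHom.ker (evalMat (genMatField σ))).IsPrime := RingHom.ker_isPrime _
  refine Ideal.map_isPrime_of_surjective Ideal.Quotient.mk_surjective ?_
  rw [Ideal.mk_ker]
  exact brauerIdeal_le_ker_iff.mpr (isPt_genMatField hσ)

lemma cellIdeal_le_of_inCell (hσ : Function.Involutive σ) {x : PrimeSpectrum (CoordRing N)}
    (hx : InCell σ (matrixAt x)) : cellIdeal σ ≤ x.asIdeal := by
  intro f hf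
  obtain ⟨f, rfl⟩ := Ideal.Quotient.mk_surjective f
  rw [mk_mem_cellIdeal_iff hσ] at hf
  rw [mk_mem_asIdeal_iff]
  exact hx.evalMat_eq_zero hσ hf

/-- The dimension of the closure of a point in the cell of `σ` is bounded. -/
theorem trdeg_le_of_inCell (hσ : Function.Involutive σ) {x : PrimeSpectrum (CoordRing N)}
    (hx : InCell σ (matrixAt x)) {s : ℕ} (hs : Algebra.trdeg ℂ (CoordRing N ⧸ x.asIdeal) = s) :
    2 * s + (Function.fixedPoints σ).ncard ≤ N * N := by
  obtain ⟨S, hS, hgen⟩ := hx.exists_generators (k := ℂ) hσ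
  have h1 : Algebra.trdeg ℂ x.asIdeal.ResidueField ≤ Cardinal.mk (S : Set x.asIdeal.ResidueField) := by
    refine trdeg_le_of_generate _ fun F hF hSF => ?_
    have h2 := hgen F hF hSF
    have h3 : ∀ f, algebraMap (CoordRing N) x.asIdeal.ResidueField f ∈ F := by
      intro f
      obtain ⟨f, rfl⟩ := Ideal.Quotient.mk_surjective f
      rw [algebraMap_residueField_mk]
      induction f using MvPolynomial.induction_on with
      | C a => rw [evalMat, MvPolynomial.aeval_C]; exact hF a
      | add p q hp hq => rw [map_add]; exact add_mem hp hq
      | mul_X p v hp =>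
        rw [map_mul]
        exact mul_mem hp (by rw [evalMat_X]; exact h2 _ _)
    refine eq_top_iff.mpr fun z _ => ?_
    obtain ⟨a, b, -, rfl⟩ := IsFractionRing.div_surjective (A := CoordRing N ⧸ x.asIdeal) z
    obtain ⟨a, rfl⟩ := Ideal.Quotient.mk_surjective a
    obtain ⟨b, rfl⟩ := Ideal.Quotient.mk_surjective b
    exact div_mem (h3 a) (h3 b)
  have h2 : Algebra.trdeg ℂ (CoordRing N ⧸ x.asIdeal) ≤ Algebra.trdeg ℂ x.asIdeal.ResidueField :=
    trdeg_le_of_injective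
      (IsScalarTower.toAlgHom ℂ (CoordRing N ⧸ x.asIdeal) x.asIdeal.ResidueField)
      x.asIdeal.injective_algebraMap_quotient_residueField
  have h3 : (s : Cardinal) ≤ S.card := by
    rw [← hs]
    refine (h2.trans h1).trans (le_of_eq ?_)
    simp
  have h4 : s ≤ S.card := by exact_mod_cast h3
  have h5 := two_mul_finrank_add (K := x.asIdeal.ResidueField) hσ
  omega

/-- The dimension of the closure of the cell of `σ` is at least the expected one. -/
theorem le_trdeg_cellIdeal (hσ : Function.Involutive σ) {s : ℕ}
    (hs : Algebra.trdeg ℂ (CoordRing N ⧸ cellIdeal σ) = s) :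
    N * N ≤ 2 * s + (Function.fixedPoints σ).ncard := by
  set A := (evalMat (genMatField σ)).range with hA
  obtain ⟨S, hS, hgen⟩ := exists_param_generators (σ := σ) (det_genLeft_ne_zero (N := N))
    (toField_X_ne_zero none) hσ ((genRight N).map (toField N))
  -- `A` is the coordinate ring of the closure of the cell. The transcendence degree of the
  -- parameters over `A` is the dimension of a generic fibre, bounded by the number of elements
  -- needed to recover the parameters.
  have h1 : Algebra.trdeg A (ParamField N) ≤ Cardinal.mk (S : Set (ParamField N)) := by
    refine trdeg_le_of_generate _ fun F hF hSF => ?_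
    obtain ⟨h2, h3, h4⟩ := hgen F (fun i j =>
      hF ⟨genMatField σ i j, MvPolynomial.X (i, j), evalMat_X _ i j⟩) hSF
    have h5 : ∀ f, algebraMap (ParamRing N) (ParamField N) f ∈ F := by
      intro f
      induction f using MvPolynomial.induction_on with
      | C a => exact hF ⟨algebraMap ℂ (ParamField N) a, A.algebraMap_mem a⟩
      | add p q hp hq => rw [map_add]; exact add_mem hp hq
      | mul_X p v hp =>
        rw [map_mul]
        refine mul_mem hp ?_
        match v with
        | none => exact h3
        | some (Sum.inl v) => exact h2 v.1 v.2
        | some (Sum.inr v) => exact h4 v.1 v.2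
    refine eq_top_iff.mpr fun z _ => ?_
    obtain ⟨a, b, -, rfl⟩ := IsFractionRing.div_surjective (A := ParamRing N) z
    exact div_mem (h5 a) (h5 b)
  have h2 : Algebra.trdeg ℂ (ParamRing N) ≤ Algebra.trdeg ℂ (ParamField N) :=
    trdeg_le_of_injective (toField N) toField_injective
  have : FaithfulSMul ℂ A :=
    (faithfulSMul_iff_algebraMap_injective ℂ A).mpr (algebraMap ℂ A).injective
  have h3 := trdeg_add_eq ℂ A (A := ParamField N)
  let φ : (CoordRing N ⧸ cellIdeal σ) →ₐ[ℂ] A :=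
    Ideal.Quotient.liftₐ (cellIdeal σ)
      (Ideal.Quotient.liftₐ (brauerIdeal N) (evalMat (genMatField σ)).rangeRestrict
        fun f hf => Subtype.ext (brauerIdeal_le_ker_iff.mpr (isPt_genMatField hσ) hf))
      fun f hf => by
        obtain ⟨f, rfl⟩ := Ideal.Quotient.mk_surjective f
        exact Subtype.ext ((mk_mem_cellIdeal_iff hσ f).mp hf)
  have hφ : Function.Surjective φ := by
    rintro ⟨_, f, rfl⟩
    exact ⟨Ideal.Quotient.mk _ (Ideal.Quotient.mk _ f), rfl⟩
  have h4 : Algebra.trdeg ℂ A ≤ s := hs ▸ trdeg_le_of_surjective φ hφ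
  -- There are N² entries of β, N² entries of Y, and the scalar c.
  have h5 : ((N * N + N * N + 1 : ℕ) : Cardinal) ≤ ((s + S.card : ℕ) : Cardinal) := by
    calc ((N * N + N * N + 1 : ℕ) : Cardinal) = Algebra.trdeg ℂ (ParamRing N) := by
          rw [MvPolynomial.trdeg_of_isDomain]
          simp [ParamIdx]
      _ ≤ _ := h2
      _ = _ := h3.symm
      _ ≤ s + Cardinal.mk (S : Set (ParamField N)) := add_le_add h4 h1
      _ = _ := by simp
  have h6 : N * N + N * N + 1 ≤ s + S.card := by exact_mod_cast h5
  have h7 := two_mul_finrank_add (K := ParamField N) hσ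
  omega

end Generic

end BrauerLoop

namespace BrauerLoop

open Matrix Module

/-! ### The locus of a link pattern and the insertion of an arc -/

section Loc

variable {N : ℕ} {K : Type*} [Field K]

/-- The diagonal entries of the square of `M` coincide exactly along the orbits of `π`. -/
def InLoc (π : Equiv.Perm (Fin N)) (M : Matrix (Fin N) (Fin N) K) : Prop :=
  ∀ i j : Fin N, (M * M) i i = (M * M) j j ↔ (j = i ∨ j = π i)

lemma eq_or_eq_of_max_min {a b c d : Fin N} (h1 : max a b = max c d) (h2 : min a b = min c d) :
    c = a ∨ c = b := by
  rcases le_total a b with h | h <;> rcases le_total c d with h' | h' <;>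
    simp only [max_eq_left, max_eq_right, min_eq_left, min_eq_right, h, h'] at h1 h2 <;>
    simp [h1, h2]

lemma genMatField_sq_diag {π : Equiv.Perm (Fin N)} (hπ : Function.Involutive π) :
    ∃ μ : ParamField N, μ ≠ 0 ∧ ∀ i, (genMatField π * genMatField π) i i = μ *
      if i = π i then 0 else
        toField N (MvPolynomial.X (some (Sum.inr (max i (π i), min i (π i))))) := by
  refine ⟨_, pow_ne_zero 2 (mul_ne_zero (toField_X_ne_zero none) det_genLeft_ne_zero),
    fun i => ?_⟩
  rw [genMatField, paramMat_sq_diag hπ det_genLeft_ne_zero]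
  congr 1
  by_cases h : i = π i
  · rw [if_pos h, if_pos h]
  rw [if_neg h, if_neg h, proj_apply]
  have key : ∀ k l : Fin N, l < k → π k = l → π l = k →
      (if l < k then
        if π k < k ∧ π l < l ∧ l < π k then ((genRight N).map (toField N)) k l
        else if k < π k ∧ l < π l ∧ π l < k then -((genRight N).map (toField N)) (π k) (π l)
        else if (π k < k ∧ l < π k ∧ l ≤ π l) ∨ (l < π l ∧ π l < k ∧ π k ≤ k) then 0
        else ((genRight N).map (toField N)) k l
      else 0) = toField N (MvPolynomial.X (some (Sum.inr (k, l)))) := by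
    intro k l h1 h2 h3
    rw [if_pos h1, h2, h3, if_neg (fun h => lt_irrefl _ h.2.2), if_neg (fun h => lt_irrefl _ h.2.2),
      if_neg]
    · simp [genRight]
    · rintro (h | h)
      · exact lt_irrefl _ h.2.1
      · exact lt_irrefl _ h.2.1
  rcases lt_or_gt_of_ne h with h1 | h1
  · rw [max_eq_right h1.le, min_eq_left h1.le]
    exact key _ _ h1 (hπ i) rfl
  · rw [max_eq_left h1.le, min_eq_right h1.le]
    exact key _ _ h1 rfl (hπ i)

/-- The generic point of the cell of `π` lies in the locus of `π`. -/
lemma inLoc_genMatField {π : Equiv.Perm (Fin N)} (hπ : Function.Involutive π)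
    (hfix : ∀ i j, π i = i → π j = j → i = j) :
    InLoc π (genMatField π) ∧ ∀ i, π i ≠ i → (genMatField π * genMatField π) i i ≠ 0 := by
  obtain ⟨μ, hμ, h⟩ := genMatField_sq_diag hπ
  constructor
  · intro i j
    rw [h, h, mul_right_inj' hμ]
    constructor
    · intro h1
      by_cases hi : i = π i <;> by_cases hj : j = π j
      · exact Or.inl (hfix j i hj.symm hi.symm)
      · rw [if_pos hi, if_neg hj] at h1
        exact absurd h1.symm (toField_X_ne_zero _)
      · rw [if_neg hi, if_pos hj] at h1
        exact absurd h1 (toField_X_ne_zero _)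
      · rw [if_neg hi, if_neg hj] at h1
        -- The value on an arc is, up to the common factor `μ`, the variable indexed by its ends, so
        -- equal values come from the same arc.
        have h2 := MvPolynomial.X_injective (toField_injective h1)
        simp only [Option.some.injEq, Sum.inr.injEq, Prod.mk.injEq] at h2
        exact eq_or_eq_of_max_min h2.1 h2.2
    · rintro (rfl | rfl)
      · rfl
      · rw [hπ i, max_comm (π i), min_comm (π i)]
        by_cases hi : i = π i
        · rw [if_pos hi, if_pos hi.symm]
        · rw [if_neg hi, if_neg (Ne.symm hi)]
  · intro i hi
    rw [h, if_neg (Ne.symm hi)]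
    exact mul_ne_zero hμ (toField_X_ne_zero _)

/-- A point of the locus of `π` lies in the cell of `π` if the square has no unexpected zeros on
the diagonal. -/
lemma IsPt.inCell_of_inLoc {π : Equiv.Perm (Fin N)} {M : Matrix (Fin N) (Fin N) K} (hM : IsPt M)
    (hloc : InLoc π M) (hne : ∀ i, π i ≠ i → (M * M) i i ≠ 0) : InCell π M := by
  obtain ⟨σ, hσ, hcell⟩ := hM.exists_inCell
  have : σ = π := by
    ext1 i
    obtain ⟨h1, h2⟩ := hcell.sq_diag hσ i
    rcases (hloc i (σ i)).mp h1.symm with h | h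
    · by_contra h3
      refine hne i (fun h4 => h3 (by rw [h, h4])) (h2 h)
    · exact h
  exact this ▸ hcell

/-- The elementary matrix at the position `(z, q)`. -/
def elemMat (K : Type*) [Field K] (z q : Fin N) : Matrix (Fin N) (Fin N) K :=
  Matrix.of fun i j => if i = z ∧ j = q then 1 else 0

lemma elemMat_mul_apply (z q : Fin N) (B : Matrix (Fin N) (Fin N) K) (i j : Fin N) :
    (elemMat K z q * B) i j = if i = z then B q j else 0 := by
  rw [Matrix.mul_apply, Finset.sum_eq_single q]
  · simp [elemMat]
  · intro k _ hk; simp [elemMat, hk]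
  · simp

lemma mul_elemMat_apply (z q : Fin N) (B : Matrix (Fin N) (Fin N) K) (i j : Fin N) :
    (B * elemMat K z q) i j = if j = q then B i z else 0 := by
  rw [Matrix.mul_apply, Finset.sum_eq_single z]
  · simp [elemMat]
  · intro k _ hk; simp [elemMat, hk]
  · simp

/-- The first order correction of the lower part when an arc starting at the first index `z` is
opened. -/
def openArc (σ : Equiv.Perm (Fin N)) (z q : Fin N) (X : Matrix (Fin N) (Fin N) K) :
    Matrix (Fin N) (Fin N) K :=
  Matrix.of fun j k => if k = q ∧ q < j ∧ σ j < j ∧ q < σ j then -X (σ j) z else 0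

section Deform

variable {σ π : Equiv.Perm (Fin N)} {z q : Fin N} {X : Matrix (Fin N) (Fin N) K}

lemma deform_sq (hσ : Function.Involutive σ) (hz : ∀ j, z ≤ j) (hqz : q ≠ z) (hσq : σ q = q)
    (t : K) :
    (arcMat K σ + t • elemMat K z q) * (arcMat K σ + t • elemMat K z q) = 0 := by
  have h1 : arcMat K σ * elemMat K z q = 0 := by
    ext i j
    rw [mul_elemMat_apply, isStrictUpper_arcMat σ i z (hz i), ite_self]; rfl
  have h2 : elemMat K z q * arcMat K σ = 0 := by
    ext i j
    rw [elemMat_mul_apply]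
    have : arcMat K σ q j = 0 := by
      simp only [arcMat, Matrix.of_apply]
      rw [if_neg]
      rintro ⟨h, h'⟩
      have : j = q := by rw [← hσ j, h', hσq]
      exact h.ne this.symm
    rw [this, ite_self]; rfl
  have h3 : elemMat K z q * elemMat K z q = 0 := by
    ext i j
    rw [elemMat_mul_apply]
    have : elemMat K z q q j = 0 := by simp [elemMat, hqz]
    rw [this, ite_self]; rfl
  simp [mul_add, add_mul, arcMat_mul_self hσ, h1, h2, h3]

/-- Since `z` is the first index, left multiplication by `elemMat K z q` fills only row `z`, which
has no lower part. The obstruction of order t is therefore X i z in column `q`. It is cancelled by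
`openArc` if i is a left end, and it is already zero if i is a right end; no other i > q occurs, as
only `z` and `q` are fixed. -/
lemma deform_anticomm (hσ : Function.Involutive σ) (hz : ∀ j, z ≤ j) (hqz : q ≠ z)
    (hσz : σ z = z) (hσq : σ q = q) (hfix : ∀ j, j ≠ z → j ≠ q → σ j ≠ j)
    (hX : low (arcMat K σ * X + X * arcMat K σ) = 0) (t : K) :
    low ((arcMat K σ + t • elemMat K z q) * (X + t • openArc σ z q X) +
      (X + t • openArc σ z q X) * (arcMat K σ + t • elemMat K z q)) = 0 := by
  have hX' : ∀ i, q < i → σ i < i → X i z = 0 := by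
    intro i hqi hi
    have h1 := congrFun (congrFun hX (σ i)) z
    have h2 : z < σ i := by
      refine lt_of_le_of_ne (hz _) fun h => ?_
      have : i = z := by rw [← hσ i, ← h, hσz]
      rw [this] at hqi
      exact absurd hqi (not_lt.mpr (hz q))
    rw [low_arcMat_anticomm_apply hσ, if_pos h2, hσ i, if_pos hi, hσz, if_neg (lt_irrefl z),
      add_zero] at h1
    exact h1
  -- No correction of order t² is needed: column `z` of `openArc` is zero.
  have h2 : low (elemMat K z q * openArc σ z q X + openArc σ z q X * elemMat K z q) = 0 := by
    ext i j
    rw [low_apply]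
    split_ifs with hij
    · rw [Matrix.add_apply, elemMat_mul_apply, mul_elemMat_apply,
        if_neg (fun h : i = z => absurd (h ▸ hij) (not_lt.mpr (hz j)))]
      have : openArc σ z q X i z = 0 := by
        simp only [openArc, Matrix.of_apply]
        exact if_neg fun h => hqz h.1.symm
      rw [this, ite_self, add_zero]; rfl
    · rfl
  have h1 : low (arcMat K σ * openArc σ z q X + openArc σ z q X * arcMat K σ +
      (elemMat K z q * X + X * elemMat K z q)) = 0 := by
    ext i j
    rw [low_apply]
    split_ifs with hij
    swap
    · rfl
    have hiz : i ≠ z := fun h => absurd (h ▸ hij) (not_lt.mpr (hz j))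
    rw [Matrix.add_apply, Matrix.add_apply, Matrix.add_apply, elemMat_mul_apply,
      mul_elemMat_apply, arcMat_mul_apply hσ, mul_arcMat_apply, if_neg hiz]
    have e1 : (if σ j < j then openArc σ z q X i (σ j) else 0) = 0 := by
      split_ifs with h
      · simp only [openArc, Matrix.of_apply]
        rw [if_neg]
        rintro ⟨h1, -⟩
        have : j = q := by rw [← hσ j, h1, hσq]
        rw [h1, this] at h
        exact lt_irrefl _ h
      · rfl
    rw [e1]
    simp only [openArc, Matrix.of_apply, hσ i, Matrix.zero_apply]
    by_cases hj : j = q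
    · have hqi : q < i := hj ▸ hij
      by_cases hi : i < σ i
      · rw [if_pos hi, if_pos ⟨hj, hqi.trans hi, hi, hqi⟩, if_pos hj]
        ring
      · rw [if_neg hi, if_pos hj, hX' i hqi
          (lt_of_le_of_ne (not_lt.mp hi) (hfix i hiz hqi.ne'))]
        ring
    · rw [if_neg hj, if_neg fun h : j = q ∧ _ => hj h.1, ite_self]
      ring
  have h3 : (arcMat K σ + t • elemMat K z q) * (X + t • openArc σ z q X) +
      (X + t • openArc σ z q X) * (arcMat K σ + t • elemMat K z q) =
      (arcMat K σ * X + X * arcMat K σ) +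
      (t • (arcMat K σ * openArc σ z q X + openArc σ z q X * arcMat K σ +
      (elemMat K z q * X + X * elemMat K z q)) +
      (t * t) • (elemMat K z q * openArc σ z q X + openArc σ z q X * elemMat K z q)) := by
    simp only [mul_add, add_mul, Matrix.smul_mul, Matrix.mul_smul, smul_add, smul_smul]
    abel
  rw [h3, low_add, hX, low_add, low_smul, low_smul, h1, h2]
  simp

/-- For t ≠ 0 the diagonal matrix is invertible, so the deformed upper part is conjugate to `arcMat
π`. At t = 0 it degenerates to `arcMat σ`. -/
lemma deform_torus (hπ : Function.Involutive π) (hz : ∀ j, z ≤ j) (hq : π z = q) (hqz : q ≠ z)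
    (hσz : σ z = z) (hσq : σ q = q) (hσπ : ∀ j, j ≠ z → j ≠ q → σ j = π j) (t : K) :
    (arcMat K σ + t • elemMat K z q) * Matrix.diagonal (fun i => if i = z then t else 1) =
      Matrix.diagonal (fun i => if i = z then t else 1) * arcMat K π := by
  ext i j
  rw [Matrix.mul_diagonal, Matrix.diagonal_mul, Matrix.add_apply, Matrix.smul_apply, smul_eq_mul]
  simp only [arcMat, elemMat, Matrix.of_apply]
  by_cases hj : j = z
  · subst hj
    rw [if_neg fun h : i < j ∧ _ => absurd h.1 (not_lt.mpr (hz i)),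
      if_neg fun h : i < j ∧ _ => absurd h.1 (not_lt.mpr (hz i)),
      if_neg fun h : i = j ∧ _ => hqz h.2.symm]
    ring
  · rw [if_neg hj]
    by_cases hjq : j = q
    · subst hjq
      have hπj : π j = z := by rw [← hq, hπ]
      rw [hσq, hπj, if_neg fun h : i < j ∧ j = i => h.1.ne h.2.symm]
      by_cases hi : i = z
      · subst hi
        rw [if_pos ⟨rfl, rfl⟩, if_pos rfl, if_pos ⟨lt_of_le_of_ne (hz j) (Ne.symm hqz), rfl⟩]
        ring
      · rw [if_neg fun h : i = z ∧ _ => hi h.1, if_neg hi,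
          if_neg fun h : _ ∧ z = i => hi h.2.symm]
        ring
    · rw [hσπ j hj hjq, if_neg fun h : _ ∧ j = q => hjq h.2]
      by_cases hi : i = z
      · have : ¬ (i < j ∧ π j = i) := by
          rintro ⟨-, h⟩
          rw [hi] at h
          exact hjq (by rw [← hq, ← h, hπ])
        rw [if_neg this]
        ring
      · rw [if_neg hi]
        ring

end Deform

variable [Algebra ℂ K]

/-- A polynomial which vanishes on all but one point of a line vanishes on the line. -/
lemma evalMat_eq_zero_of_line (f : MvPolynomial (Fin N × Fin N) ℂ)
    (M C : Matrix (Fin N) (Fin N) K) (h : ∀ t : K, t ≠ 0 → evalMat (M + t • C) f = 0) :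
    evalMat M f = 0 := by
  have : Infinite K := Infinite.of_injective _ (algebraMap ℂ K).injective
  set g : Polynomial K := evalMat (M.map Polynomial.C + (Polynomial.X : Polynomial K) •
    C.map Polynomial.C) f with hg
  have hev : ∀ t : K, g.eval t = evalMat (M + t • C) f := by
    intro t
    have h1 := map_evalMat ((Polynomial.aeval t : Polynomial K →ₐ[K] K).restrictScalars ℂ)
      (M.map Polynomial.C + (Polynomial.X : Polynomial K) • C.map Polynomial.C) f
    rw [← hg] at h1
    have h2 : (M.map Polynomial.C + (Polynomial.X : Polynomial K) • C.map Polynomial.C).map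
        ((Polynomial.aeval t : Polynomial K →ₐ[K] K).restrictScalars ℂ) = M + t • C := by
      ext i j
      simp [mul_comm t]
    rw [h2] at h1
    rw [← h1]
    simp [Polynomial.aeval_def]
  have hg0 : g = 0 := by
    refine Polynomial.eq_zero_of_infinite_isRoot g (Set.Infinite.mono (s := {0}ᶜ) ?_ ?_)
    · intro t ht
      exact (hev t).trans (h t ht)
    · exact (Set.finite_singleton (0 : K)).infinite_compl
  have := hev 0
  rw [hg0, Polynomial.eval_zero, zero_smul, add_zero] at this
  exact this.symm

/-- Points in the cell of `π` with one arc removed, the removed arc starting at the first index,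
are limits of points in the cell of `π`. -/
lemma evalMat_eq_zero_of_remove_arc {σ π : Equiv.Perm (Fin N)} (hσ : Function.Involutive σ)
    (hπ : Function.Involutive π) {z : Fin N} (hz : ∀ j, z ≤ j) (hqz : π z ≠ z)
    (hσz : σ z = z) (hσq : σ (π z) = π z)
    (hσπ : ∀ j, j ≠ z → j ≠ π z → σ j = π j ∧ σ j ≠ j)
    {M : Matrix (Fin N) (Fin N) K} (hM : InCell σ M) {f : MvPolynomial (Fin N × Fin N) ℂ}
    (hf : evalMat (genMatField π) f = 0) : evalMat M f = 0 := by
  obtain ⟨b, X, hb, hd, hXl, hX, hMX⟩ := hM.exists_normal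
  set q := π z with hq
  -- The deformation at the normal form, transported by `b`, is a line through `M` whose other
  -- points lie in the cell of `π`.
  refine evalMat_eq_zero_of_line f M
    (b * elemMat K z q * b⁻¹ + low (b * openArc σ z q X * b⁻¹)) fun t ht => ?_
  set U := arcMat K σ + t • elemMat K z q with hU
  set Y := X + t • openArc σ z q X with hY
  have hline : M + t • (b * elemMat K z q * b⁻¹ + low (b * openArc σ z q X * b⁻¹)) =
      b * U * b⁻¹ + low (b * Y * b⁻¹) := by
    rw [hMX, hU, hY]
    simp only [mul_add, add_mul, Matrix.mul_smul, Matrix.smul_mul, low_add, low_smul, smul_add]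
    abel
  have hUs : IsStrictUpper U := by
    intro i j hij
    rw [hU, Matrix.add_apply, isStrictUpper_arcMat σ i j hij, Matrix.smul_apply]
    simp only [elemMat, Matrix.of_apply]
    rw [if_neg, smul_zero, add_zero]
    rintro ⟨rfl, rfl⟩
    exact hqz (le_antisymm hij (hz _))
  obtain ⟨h1, h2, -⟩ := isPt_conj hb hd hUs (deform_sq hσ hz hqz hσq t)
    (deform_anticomm hσ hz hqz hσz hσq (fun j h h' => (hσπ j h h').2) hX t)
  rw [hline]
  set τ : Matrix (Fin N) (Fin N) K := Matrix.diagonal (fun i => if i = z then t else 1) with hτ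
  have hτu : τ.IsUpperTriangular := fun i j h => Matrix.diagonal_apply_ne _ (ne_of_gt h)
  have hτd : τ.det ≠ 0 := by
    rw [hτ, Matrix.det_diagonal]
    refine Finset.prod_ne_zero_iff.mpr fun i _ => ?_
    split_ifs
    exacts [ht, one_ne_zero]
  refine InCell.evalMat_eq_zero hπ hf ⟨h1, b * τ, BlockTriangular.mul hb hτu, ?_, ?_⟩
  · rw [Matrix.det_mul]
    exact mul_ne_zero hd hτd
  · have hτU : U * τ = τ * arcMat K π :=
      deform_torus hπ hz hq.symm hqz hσz hσq (fun j h h' => (hσπ j h h').1) t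
    rw [h2, Matrix.mul_assoc, Matrix.mul_assoc, ← Matrix.mul_assoc b⁻¹,
      nonsing_inv_mul b (isUnit_iff_ne_zero.mpr hd), Matrix.one_mul, hτU, Matrix.mul_assoc]

end Loc

/-! ### Cyclic symmetry, and the locus in the closure of the cell -/

section Rotation

variable {N : ℕ} {K : Type*} [Field K]

/-- Translation modulo N preserves the cyclic order. -/
lemma exists_rotation (z i : Fin N) : ∃ e : Equiv.Perm (Fin N), e z = i ∧
    ∀ a b c, CycLE (e a) (e b) (e c) ↔ CycLE a b c := by
  have : NeZero N := ⟨fun h => by subst h; exact z.elim0⟩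
  refine ⟨Equiv.addRight (i - z), by simp, fun a b c => ?_⟩
  simp only [CycLE, Equiv.coe_addRight, Fin.le_def, Fin.ext_iff, Fin.val_add_eq_ite]
  have ha := a.2
  have hb := b.2
  have hc := c.2
  have hd := (i - z).2
  generalize ((i - z : Fin N) : ℕ) = d at hd ⊢
  split_ifs <;> omega

lemma IsPt.submatrix {e : Equiv.Perm (Fin N)} (he : ∀ a b c, CycLE (e a) (e b) (e c) ↔ CycLE a b c)
    {M : Matrix (Fin N) (Fin N) K} (hM : IsPt M) : IsPt (M.submatrix e e) := by
  refine ⟨fun i => hM.1 (e i), ?_⟩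
  ext i k
  have h := congrFun (congrFun hM.2 (e i)) (e k)
  simp only [cycMul, Matrix.of_apply, Matrix.zero_apply] at h
  rw [← Equiv.sum_comp e] at h
  simp only [he] at h
  exact h

lemma submatrix_sq_diag (e : Equiv.Perm (Fin N)) (M : Matrix (Fin N) (Fin N) K) (i : Fin N) :
    (M.submatrix e e * M.submatrix e e) i i = (M * M) (e i) (e i) := by
  rw [Matrix.submatrix_mul_equiv]
  rfl

lemma InLoc.submatrix {π : Equiv.Perm (Fin N)} {M : Matrix (Fin N) (Fin N) K} (h : InLoc π M)
    (e : Equiv.Perm (Fin N)) : InLoc ((e.trans π).trans e.symm) (M.submatrix e e) := by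
  intro i j
  rw [submatrix_sq_diag, submatrix_sq_diag, h (e i) (e j)]
  simp only [Equiv.trans_apply, EmbeddingLike.apply_eq_iff_eq, Equiv.eq_symm_apply]

variable [Algebra ℂ K]

lemma evalMat_submatrix (e : Equiv.Perm (Fin N)) (M : Matrix (Fin N) (Fin N) K)
    (f : MvPolynomial (Fin N × Fin N) ℂ) :
    evalMat M (MvPolynomial.rename (Prod.map e e) f) = evalMat (M.submatrix e e) f := by
  rw [evalMat, MvPolynomial.aeval_rename]
  rfl

/-- The locus of `π` is contained in the closure of the cell of `π`. -/
theorem evalMat_eq_zero_of_inLoc {π : Equiv.Perm (Fin N)} (hπ : Function.Involutive π)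
    (hfix : ∀ i j, π i = i → π j = j → i = j) {M : Matrix (Fin N) (Fin N) K} (hM : IsPt M)
    (hloc : InLoc π M) {f : MvPolynomial (Fin N × Fin N) ℂ}
    (hf : evalMat (genMatField π) f = 0) : evalMat M f = 0 := by
  by_cases hne : ∀ i, π i ≠ i → (M * M) i i ≠ 0
  · exact (hM.inCell_of_inLoc hloc hne).evalMat_eq_zero hπ hf
  push Not at hne
  obtain ⟨i₀, hi₀, hs⟩ := hne
  set z : Fin N := ⟨0, i₀.pos⟩
  have hz : ∀ j, z ≤ j := fun j => Nat.zero_le _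
  obtain ⟨e, hez, he⟩ := exists_rotation z i₀
  have he' : ∀ a b c, CycLE (e.symm a) (e.symm b) (e.symm c) ↔ CycLE a b c := fun a b c => by
    rw [← he]; simp
  set ρ : Equiv.Perm (Fin N) := (e.trans π).trans e.symm with hρdef
  have hρ : Function.Involutive ρ := fun i => by simp [hρdef, hπ _]
  have hρfix : ∀ i j, ρ i = i → ρ j = j → i = j := by
    intro i j hi hj
    simp only [hρdef, Equiv.trans_apply, Equiv.symm_apply_eq] at hi hj
    exact e.injective (hfix _ _ hi hj)
  have hρz : ρ z ≠ z := by
    intro h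
    simp only [hρdef, Equiv.trans_apply, Equiv.symm_apply_eq, hez] at h
    exact hi₀ h
  have hM' := hM.submatrix he
  have hloc' := hloc.submatrix e
  rw [← hρdef] at hloc'
  have hs' : (M.submatrix e e * M.submatrix e e) z z = 0 := by
    rw [submatrix_sq_diag, hez, hs]
  set f' := MvPolynomial.rename (Prod.map e.symm e.symm) f with hf'def
  have hMf : evalMat M f = evalMat (M.submatrix e e) f' := by
    rw [hf'def, evalMat_submatrix, Matrix.submatrix_submatrix]
    simp
  -- Rotating back the generic point of the cell of `ρ` gives a point of the locus of `π` without
  -- unexpected zeros, hence of the cell of `π`. This avoids any direct comparison of rotation with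
  -- the cells.
  have hf' : evalMat (genMatField ρ) f' = 0 := by
    obtain ⟨g1, g2⟩ := inLoc_genMatField hρ hρfix
    have g3 := (isPt_genMatField hρ).submatrix he'
    have g4 := g1.submatrix e.symm
    have g5 : (e.symm.trans ρ).trans e.symm.symm = π := by
      ext i; simp [hρdef]
    rw [g5] at g4
    rw [hf'def, evalMat_submatrix]
    refine (g3.inCell_of_inLoc g4 fun i hi => ?_).evalMat_eq_zero hπ hf
    rw [submatrix_sq_diag]
    refine g2 _ fun h => hi ?_
    simpa [hρdef] using h
  rw [hMf]
  set M' := M.submatrix e e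
  obtain ⟨σ, hσ, hcell⟩ := hM'.exists_inCell
  have hσmem : ∀ i, σ i = i ∨ σ i = ρ i := fun i =>
    (hloc' i (σ i)).mp (hcell.sq_diag hσ i).1.symm
  -- The square has diagonal entry zero at every fixed point of `σ`, and also at `z`; the locus
  -- allows this only at the two ends of one arc. So `σ` is `ρ`, or `ρ` with the arc through `z`
  -- removed.
  have hσfix : ∀ i, σ i = i → i = z ∨ i = ρ z := fun i hi =>
    (hloc' z i).mp (by rw [hs', (hcell.sq_diag hσ i).2 hi])
  by_cases hσρ : σ = ρ
  · subst hσρ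
    exact hcell.evalMat_eq_zero hσ hf'
  have hj : σ z = z ∨ σ (ρ z) = ρ z := by
    obtain ⟨j, hj⟩ : ∃ j, σ j ≠ ρ j := by
      by_contra h
      push Not at h
      exact hσρ (Equiv.ext h)
    have hj' : σ j = j := (hσmem j).resolve_right hj
    rcases hσfix j hj' with rfl | rfl
    · exact Or.inl hj'
    · exact Or.inr hj'
  have hσz : σ z = z := by
    rcases hj with h | h
    · exact h
    · rcases hσmem z with h' | h'
      · exact h'
      · have : σ (σ z) = σ z := by rw [h', h]
        rw [hσ z] at this
        exact this.symm
  have hσq : σ (ρ z) = ρ z := by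
    rcases hσmem (ρ z) with h' | h'
    · exact h'
    · rw [hρ z] at h'
      have : σ (σ (ρ z)) = σ z := by rw [h']
      rw [hσ, hσz] at this
      exact absurd this hρz
  refine evalMat_eq_zero_of_remove_arc hσ hρ hz hρz hσz hσq (fun j h1 h2 => ?_) hcell hf'
  have h3 : σ j ≠ j := fun h => (hσfix j h).elim h1 h2
  exact ⟨(hσmem j).resolve_left h3, h3⟩

end Rotation

end BrauerLoop

namespace BrauerLoop

open Matrix Module

/-! ### Dimensions of quotients and closed subsets -/

section Topology

/-- The dimension of a closed subset of a spectrum. -/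
lemma topologicalKrullDim_zeroLocus {R : Type*} [CommRing R] (I : Ideal R) :
    topologicalKrullDim (PrimeSpectrum.zeroLocus (I : Set R)) = ringKrullDim (R ⧸ I) := by
  have h := PrimeSpectrum.isClosedEmbedding_comap_of_surjective (R ⧸ I) (Ideal.Quotient.mk I)
    Ideal.Quotient.mk_surjective
  have hr : Set.range (PrimeSpectrum.comap (Ideal.Quotient.mk I)) =
      PrimeSpectrum.zeroLocus (I : Set R) := by
    rw [_root_.range_comap_of_surjective _ _ Ideal.Quotient.mk_surjective, Ideal.mk_ker]
  rw [← PrimeSpectrum.topologicalKrullDim_eq_ringKrullDim, ← hr]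
  exact (IsHomeomorph.topologicalKrullDim_eq _
    h.isEmbedding.toHomeomorph.isHomeomorph).symm

/-- The dimension of a nontrivial ring whose primes have quotients of dimension at most `d`. -/
lemma ringKrullDim_le_of_forall_quotient {R : Type*} [CommRing R] {d : WithBot ℕ∞}
    (h : ∀ p : PrimeSpectrum R, ringKrullDim (R ⧸ p.asIdeal) ≤ d) : ringKrullDim R ≤ d := by
  -- A chain of primes lies entirely in the zero locus of its smallest member.
  refine iSup_le fun l => le_trans ?_ (h l.head)
  rw [ringKrullDim_quotient]
  let L : LTSeries (PrimeSpectrum.zeroLocus (R := R) (l.head.asIdeal : Set R)) :=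
    { length := l.length
      toFun := fun i => ⟨l i, LTSeries.head_le l i⟩
      step := fun i => l.step i }
  exact Order.LTSeries.length_le_krullDim L

/-- The dimension drops strictly along a strict inclusion of primes. -/
lemma ringKrullDim_quotient_lt_of_lt {R : Type*} [CommRing R] {p q : Ideal R} [hq : q.IsPrime]
    (hlt : q < p) {n : ℕ} (hn : ringKrullDim (R ⧸ p) = n) :
    (n : WithBot ℕ∞) < ringKrullDim (R ⧸ q) := by
  obtain ⟨r, hrp, hrq⟩ := SetLike.exists_of_lt hlt
  have h1 : Ideal.Quotient.mk q r ∈ nonZeroDivisors (R ⧸ q) := by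
    rw [mem_nonZeroDivisors_iff_ne_zero, Ne, Ideal.Quotient.eq_zero_iff_mem]
    exact hrq
  have h2 := ringKrullDim_quotient_succ_le_of_nonZeroDivisor h1
  have h3 : ringKrullDim (R ⧸ p) ≤
      ringKrullDim ((R ⧸ q) ⧸ Ideal.span {Ideal.Quotient.mk q r}) := by
    refine ringKrullDim_le_of_surjective (Ideal.Quotient.lift _ (Ideal.Quotient.factor hlt.le) ?_) ?_
    · intro a ha
      obtain ⟨b, rfl⟩ := Ideal.mem_span_singleton.mp ha
      rw [map_mul, Ideal.Quotient.factor_mk, Ideal.Quotient.eq_zero_iff_mem.mpr hrp, zero_mul]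
    · intro a
      obtain ⟨a, rfl⟩ := Ideal.Quotient.mk_surjective a
      exact ⟨Ideal.Quotient.mk _ (Ideal.Quotient.mk _ a), by simp⟩
  rw [hn] at h3
  have h4 : ((n + 1 : ℕ) : WithBot ℕ∞) ≤ ringKrullDim (R ⧸ q) := by
    push_cast
    exact (add_le_add_left h3 1).trans h2
  exact lt_of_lt_of_le (by exact_mod_cast Nat.lt_succ_self n) h4

end Topology

/-! ### The components of maximal dimension -/

section Main

variable {N : ℕ}

lemma LinkPattern.fixed_unique (π : LinkPattern N) (i j : Fin N) (hi : π.1 i = i)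
    (hj : π.1 j = j) : i = j := by
  have h : (Function.fixedPoints π.1).ncard ≤ 1 := by
    rw [π.2.2]; omega
  exact (Set.ncard_le_one_iff (Set.toFinite _)).mp h hi hj

/-- The generic point of the component of a link pattern. -/
noncomputable def genPoint (π : LinkPattern N) : PrimeSpectrum (CoordRing N) :=
  ⟨cellIdeal π.1, isPrime_cellIdeal π.2.1⟩

lemma mem_locus_iff (π : LinkPattern N) (x : PrimeSpectrum (CoordRing N)) :
    x ∈ locus π ↔ InLoc π.1 (matrixAt x) := Iff.rfl

/-- The diagonal entry of the square of the coordinate matrix. -/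
noncomputable def sqDiag (i : Fin N) : MvPolynomial (Fin N × Fin N) ℂ :=
  (coordMatrix N * coordMatrix N) i i

lemma evalMat_sqDiag {R : Type*} [CommRing R] [Algebra ℂ R] (M : Matrix (Fin N) (Fin N) R)
    (i : Fin N) : evalMat M (sqDiag i) = (M * M) i i := by
  simp [sqDiag, Matrix.mul_apply, coordMatrix, evalMat_X]

/-- Membership depends only on which polynomials vanish at the point, and `genMatField π` has the
same vanishing polynomials. No identification of the residue field is needed. -/
lemma genPoint_mem_locus (π : LinkPattern N) : genPoint π ∈ locus π := by
  rw [mem_locus_iff]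
  intro i j
  rw [← (inLoc_genMatField π.2.1 π.fixed_unique).1 i j, ← sub_eq_zero,
    ← sub_eq_zero (a := (genMatField π.1 * genMatField π.1) i i), ← evalMat_sqDiag,
    ← evalMat_sqDiag, ← evalMat_sqDiag, ← evalMat_sqDiag, ← map_sub, ← map_sub,
    ← mk_mem_asIdeal_iff, ← mk_mem_cellIdeal_iff π.2.1]
  rfl

lemma cellIdeal_le_of_mem_locus (π : LinkPattern N) {x : PrimeSpectrum (CoordRing N)}
    (hx : x ∈ locus π) : cellIdeal π.1 ≤ x.asIdeal := by
  intro f hf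
  obtain ⟨f, rfl⟩ := Ideal.Quotient.mk_surjective f
  rw [mk_mem_cellIdeal_iff π.2.1] at hf
  rw [mk_mem_asIdeal_iff]
  exact evalMat_eq_zero_of_inLoc π.2.1 π.fixed_unique (isPt_matrixAt x) hx hf

lemma component_eq_zeroLocus (π : LinkPattern N) :
    (component π : Set (PrimeSpectrum (CoordRing N))) =
      PrimeSpectrum.zeroLocus (cellIdeal π.1 : Set (CoordRing N)) := by
  apply subset_antisymm
  · refine closure_minimal (fun x hx => ?_) (PrimeSpectrum.isClosed_zeroLocus _)
    exact cellIdeal_le_of_mem_locus π hx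
  · have h : closure {genPoint π} ⊆ (component π : Set (PrimeSpectrum (CoordRing N))) :=
      closure_mono (Set.singleton_subset_iff.mpr (genPoint_mem_locus π))
    rwa [PrimeSpectrum.closure_singleton] at h

lemma exists_ringKrullDim_eq (x : PrimeSpectrum (CoordRing N)) :
    ∃ s : ℕ, ringKrullDim (CoordRing N ⧸ x.asIdeal) = s ∧
      Algebra.trdeg ℂ (CoordRing N ⧸ x.asIdeal) = s :=
  exists_ringKrullDim_eq_trdeg ℂ (CoordRing N ⧸ x.asIdeal)

/-- The lower bound (N² - N mod 2)/2 equals ⌊N²/2⌋ because N² and N have the same parity. The upper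
bound holds for every point, whatever its cell. -/
lemma ringKrullDim_genPoint (π : LinkPattern N) :
    ringKrullDim (CoordRing N ⧸ cellIdeal π.1) = ((N ^ 2 / 2 : ℕ) : WithBot ℕ∞) := by
  obtain ⟨s, h1, h2⟩ := exists_ringKrullDim_eq (genPoint π)
  have h3 := le_trdeg_cellIdeal π.2.1 h2
  have h4 : s ≤ N ^ 2 / 2 := by
    obtain ⟨σ, hσ, hcell⟩ := (isPt_matrixAt (genPoint π)).exists_inCell
    have := trdeg_le_of_inCell hσ hcell h2
    rw [pow_two]; omega
  have h5 : s = N ^ 2 / 2 := by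
    rw [π.2.2] at h3
    rw [pow_two] at h4 ⊢
    rcases Nat.mod_two_eq_zero_or_one N with h | h
    · omega
    · have : N * N % 2 = 1 := by rw [Nat.mul_mod, h]
      omega
  rw [← h5]
  exact h1

lemma ringKrullDim_quotient_le (x : PrimeSpectrum (CoordRing N)) :
    ringKrullDim (CoordRing N ⧸ x.asIdeal) ≤ ((N ^ 2 / 2 : ℕ) : WithBot ℕ∞) := by
  obtain ⟨s, h1, h2⟩ := exists_ringKrullDim_eq x
  obtain ⟨σ, hσ, hcell⟩ := (isPt_matrixAt x).exists_inCell
  have h3 := trdeg_le_of_inCell hσ hcell h2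
  have h4 : s ≤ N ^ 2 / 2 := by rw [pow_two]; omega
  rw [h1]
  exact_mod_cast h4

/-- Order reversal has at most one fixed point, and its parity is that of N. Existence is needed for
the lower bound on dim E. -/
lemma exists_linkPattern (N : ℕ) : Nonempty (LinkPattern N) := by
  have hinv : Function.Involutive (Fin.revPerm : Equiv.Perm (Fin N)) := Fin.rev_rev
  refine ⟨Fin.revPerm, hinv, ?_⟩
  have h1 : (Function.fixedPoints (Fin.revPerm : Equiv.Perm (Fin N))).ncard ≤ 1 := by
    refine (Set.ncard_le_one_iff (Set.toFinite _)).mpr fun {i j} hi hj => ?_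
    have hi' : Fin.rev i = i := hi
    have hj' : Fin.rev j = j := hj
    rw [Fin.ext_iff, Fin.val_rev] at hi' hj'
    ext
    omega
  have h2 := two_mul_card_arcPos hinv
  omega

lemma ringKrullDim_coordRing : ringKrullDim (CoordRing N) = ((N ^ 2 / 2 : ℕ) : WithBot ℕ∞) := by
  refine le_antisymm (ringKrullDim_le_of_forall_quotient ringKrullDim_quotient_le) ?_
  obtain ⟨π⟩ := exists_linkPattern N
  rw [← ringKrullDim_genPoint π]
  exact _root_.ringKrullDim_quotient_le _

lemma topologicalKrullDim_component (π : LinkPattern N) :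
    topologicalKrullDim (component π : Set (PrimeSpectrum (CoordRing N))) =
      ((N ^ 2 / 2 : ℕ) : WithBot ℕ∞) := by
  refine Eq.trans ?_ ((topologicalKrullDim_zeroLocus (cellIdeal π.1)).trans
    (ringKrullDim_genPoint π))
  exact congrArg (fun Z : Set (PrimeSpectrum (CoordRing N)) => topologicalKrullDim Z)
    (component_eq_zeroLocus π)

lemma isIrreducible_component (π : LinkPattern N) :
    IsIrreducible (component π : Set (PrimeSpectrum (CoordRing N))) := by
  have h : (component π : Set (PrimeSpectrum (CoordRing N))) = closure {genPoint π} :=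
    (component_eq_zeroLocus π).trans (PrimeSpectrum.closure_singleton (genPoint π)).symm
  exact h ▸ isIrreducible_singleton.closure

/-- A strictly larger irreducible closed set would have dimension above the maximum ⌊N²/2⌋. -/
lemma component_mem_irreducibleComponents (π : LinkPattern N) :
    (component π : Set (PrimeSpectrum (CoordRing N))) ∈
      irreducibleComponents (PrimeSpectrum (CoordRing N)) := by
  refine ⟨isIrreducible_component π, fun t ht hle => ?_⟩
  have hq : (PrimeSpectrum.vanishingIdeal t).IsPrime :=
    PrimeSpectrum.isIrreducible_iff_vanishingIdeal_isPrime.mp ht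
  have hqp : PrimeSpectrum.vanishingIdeal t ≤ cellIdeal π.1 := by
    have h1 := PrimeSpectrum.vanishingIdeal_anti_mono hle
    rw [component_eq_zeroLocus, PrimeSpectrum.vanishingIdeal_zeroLocus_eq_radical,
      (isPrime_cellIdeal π.2.1).radical] at h1
    exact h1
  have heq : PrimeSpectrum.vanishingIdeal t = cellIdeal π.1 := by
    by_contra hne
    have h1 := ringKrullDim_quotient_lt_of_lt (lt_of_le_of_ne hqp hne)
      (n := N ^ 2 / 2) (ringKrullDim_genPoint π)
    exact absurd (ringKrullDim_quotient_le ⟨_, hq⟩) (not_le.mpr h1)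
  intro x hx
  rw [component_eq_zeroLocus, ← heq]
  exact PrimeSpectrum.subset_zeroLocus_vanishingIdeal t hx

/-- The component determines its generic point, whose coincidences on the diagonal of M² determine
π. -/
lemma component_injective : Function.Injective fun π : LinkPattern N =>
    (component π : Set (PrimeSpectrum (CoordRing N))) := by
  intro π π' h
  have h1 : cellIdeal π.1 = cellIdeal π'.1 := by
    have := congrArg PrimeSpectrum.vanishingIdeal h
    simpa only [component_eq_zeroLocus, PrimeSpectrum.vanishingIdeal_zeroLocus_eq_radical,
      (isPrime_cellIdeal π.2.1).radical, (isPrime_cellIdeal π'.2.1).radical] using this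
  have h2 : genPoint π = genPoint π' := PrimeSpectrum.ext h1
  have h3 := (mem_locus_iff π _).mp (genPoint_mem_locus π)
  have h4 := (mem_locus_iff π' _).mp (genPoint_mem_locus π')
  rw [h2] at h3
  refine Subtype.ext (Equiv.ext fun i => ?_)
  have h5 : ∀ j, (j = i ∨ j = π.1 i) ↔ (j = i ∨ j = π'.1 i) := fun j => (h3 i j).symm.trans (h4 i j)
  rcases (h5 (π.1 i)).mp (Or.inr rfl) with h6 | h6
  · rcases (h5 (π'.1 i)).mpr (Or.inr rfl) with h7 | h7
    · rw [h6, h7]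
    · exact h7.symm
  · exact h6

/-- The generic point of a component lies in some cell, and minimality of its prime makes the
component the closure of that cell. Maximal dimension then leaves room for at most N² mod 2 fixed
points, and their number has the parity of N. -/
lemma exists_component_eq {Z : Set (PrimeSpectrum (CoordRing N))}
    (hZ : Z ∈ irreducibleComponents (PrimeSpectrum (CoordRing N)))
    (hdim : topologicalKrullDim Z = ((N ^ 2 / 2 : ℕ) : WithBot ℕ∞)) :
    ∃ π : LinkPattern N, component π = Z := by
  rw [← PrimeSpectrum.zeroLocus_minimalPrimes] at hZ
  obtain ⟨q, hq, rfl⟩ := hZ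
  have hqp : q.IsPrime := hq.1.1
  set x : PrimeSpectrum (CoordRing N) := ⟨q, hqp⟩ with hx
  obtain ⟨σ, hσ, hcell⟩ := (isPt_matrixAt x).exists_inCell
  have hle := cellIdeal_le_of_inCell hσ hcell
  have heq : cellIdeal σ = q := le_antisymm hle (hq.2 ⟨isPrime_cellIdeal hσ, bot_le⟩ hle)
  obtain ⟨s, h1, h2⟩ := exists_ringKrullDim_eq x
  have h3 := trdeg_le_of_inCell hσ hcell h2
  have h4 : (s : WithBot ℕ∞) = ((N ^ 2 / 2 : ℕ) : WithBot ℕ∞) := by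
    rw [← h1, ← hdim]
    exact (topologicalKrullDim_zeroLocus q).symm
  have h5 : s = N ^ 2 / 2 := by exact_mod_cast h4
  have h6 := two_mul_card_arcPos hσ
  have h7 : (Function.fixedPoints σ).ncard = N % 2 := by
    rw [pow_two] at h5
    rcases Nat.mod_two_eq_zero_or_one N with h | h
    · have : N * N % 2 = 0 := by rw [Nat.mul_mod, h]
      omega
    · omega
  refine ⟨⟨σ, hσ, h7⟩, ?_⟩
  have h8 := component_eq_zeroLocus (⟨σ, hσ, h7⟩ : LinkPattern N)
  rw [heq] at h8
  exact h8

end Main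

end BrauerLoop

theorem mainTheorem6 (N : ℕ) (hN : 0 < N) :
    topologicalKrullDim (BrauerLoop.brauerLoopScheme N) = ((N ^ 2 / 2 : ℕ) : WithBot ℕ∞) ∧
    (∀ π : BrauerLoop.LinkPattern N, IsIrreducible (BrauerLoop.component π)) ∧
    Set.BijOn (fun π : BrauerLoop.LinkPattern N => BrauerLoop.component π) Set.univ
      {Z : Set (BrauerLoop.brauerLoopScheme N) |
        Z ∈ irreducibleComponents (BrauerLoop.brauerLoopScheme N) ∧
        topologicalKrullDim Z = topologicalKrullDim (BrauerLoop.brauerLoopScheme N)} := by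
  have hdim : topologicalKrullDim (BrauerLoop.brauerLoopScheme N) =
      ((N ^ 2 / 2 : ℕ) : WithBot ℕ∞) :=
    (PrimeSpectrum.topologicalKrullDim_eq_ringKrullDim _).trans BrauerLoop.ringKrullDim_coordRing
  refine ⟨hdim, BrauerLoop.isIrreducible_component, fun π _ => ⟨?_, ?_⟩, ?_, ?_⟩
  · exact BrauerLoop.component_mem_irreducibleComponents π
  · rw [hdim]
    exact BrauerLoop.topologicalKrullDim_component π
  · exact BrauerLoop.component_injective.injOn
  · rintro Z ⟨hZ, hZd⟩
    rw [hdim] at hZd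
    obtain ⟨π, hπ⟩ := BrauerLoop.exists_component_eq hZ hZd
    exact ⟨π, trivial, hπ⟩
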